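/- Let $K$ be a field and, for $n \ge 0$, let $E_n = K\langle e_1,\dots,e_n\rangle$ be the exterior algebra of the $K$-vector space with basis $e_1,\dots,e_n$. For $\sigma=\{i_1<\dots<i_d\}\subseteq\{1,\dots,n\}$ the monomial $e_\sigma = e_{i_1}\wedge\dots\wedge e_{i_d}$ has degree $d$ (with $e_\emptyset = 1$). A monomial ideal is an ideal generated by monomials; $G(I)$ denotes its unique minimal set of monomial generators. A monomial ideal $I$ is strongly stable if for each monomial $e_\sigma\in I$, each $j\in\sigma$ and each $i<j$ one has $e_i e_{\sigma\setminus\{j\}}\in I$; it is generated in degree $d$ if every element of $G(I)$ has degree $d$. For an ideal $I\subseteq E_n$ generated by monomials, the total Betti numbers are $\beta_i(I)=\dim_K \operatorname{Tor}_i^{E_n}(I,K)$, where $K=E_n/(e_1,\dots,e_n)$. For monomials of the same degree $d$, $e_{i_1}\cdots e_{i_d} >_{\mathrm{revlex}} e_{j_1}\cdots e_{j_d}$ (with $i_1<\dots<i_d$, $j_1<\dots<j_d$) means that for some $s$ one has $i_s<j_s$ and $i_r=j_r$ for all $r>s$. If $I\subsetneq E_n$ is a monomial ideal generated in degree $d$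 with $p=|G(I)|$, then for any $m$ with $\binom{m}{d}\ge p$ (for instance $m=n$, or the smallest such $m$) the colexsegment ideal associated to $I$ is the ideal $J\subseteq E_m$ generated by the $p$ largest monomials of degree $d$ of $E_m$ in the reverse lexicographic order; the generators do not depend on the choice of $m$. **Theorem.** Let $I\subsetneq E_n$ be a strongly stable ideal generated in degree $d$, let $m$ satisfy $\binom{m}{d}\ge |G(I)|$, and let $J\subseteq E_m$ be the colexsegment ideal associated to $I$. Then $I$ satisfies the colex lower bound: $\beta_i(J)\le\beta_i(I)$ for all $i\ge 0$, where $\beta_i(J)$ is computed over $E_m$ and $\beta_i(I)$ over $E_n$. -/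

import Mathlib

open CategoryTheory

open scoped ModuleCat

universe u

namespace ExteriorBetti

noncomputable section

/-- The exterior algebra `K⟨e₁, …, eₙ⟩` of the `K`-vector space with basis `e₁, …, eₙ`
(the indices are shifted to `Fin n`). -/
abbrev ExtAlg (K : Type u) [Field K] (n : ℕ) : Type u :=
  ExteriorAlgebra K (Fin n → K)

/-- The algebra generator `eᵢ`. -/
def gen (K : Type u) [Field K] {n : ℕ} (i : Fin n) : ExtAlg K n :=
  ExteriorAlgebra.ι K (Pi.single i 1)

/-- The monomial `e_σ = e_{i₁} ∧ ⋯ ∧ e_{i_d}` for `σ = {i₁ < ⋯ < i_d}`; `e_∅ = 1`. -/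
def mono (K : Type u) [Field K] {n : ℕ} (σ : Finset (Fin n)) : ExtAlg K n :=
  ExteriorAlgebra.ιMulti K σ.card fun k => Pi.single (σ.orderEmbOfFin rfl k) 1

section Ideals

variable {K : Type u} [Field K] {n : ℕ}

/-- A monomial ideal: an ideal generated by monomials. (For a noncommutative ring `Ideal` means
left ideal; a left ideal generated by monomials is two-sided, as `e_σ a` and `a e_σ` agree up to
sign for every monomial `a`.) -/
def IsMonomial (I : Ideal (ExtAlg K n)) : Prop :=
  ∃ S : Set (Finset (Fin n)), I = Ideal.span (mono K '' S)

/-- A monomial ideal is strongly stable if for each monomial `e_σ ∈ I`, each `j ∈ σ` and each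
`i < j`, also `eᵢ e_{σ ∖ {j}} ∈ I`. -/
def IsStronglyStable (I : Ideal (ExtAlg K n)) : Prop :=
  IsMonomial I ∧ ∀ σ : Finset (Fin n), mono K σ ∈ I →
    ∀ j ∈ σ, ∀ i : Fin n, i < j → gen K i * mono K (σ.erase j) ∈ I

/-- The minimal set `G(I)` of monomial generators of a monomial ideal `I`, given by the index sets
of its elements: the monomials in `I` that are minimal with respect to divisibility. -/
def minGens (I : Ideal (ExtAlg K n)) : Set (Finset (Fin n)) :=
  {σ | Minimal (fun τ => mono K τ ∈ I) σ}

/-- A monomial ideal is generated in degree `d` if all its minimal monomial generators have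
degree `d`. -/
def IsGeneratedInDegree (I : Ideal (ExtAlg K n)) (d : ℕ) : Prop :=
  ∀ σ ∈ minGens I, σ.card = d

/-- The number of minimal monomial generators of degree `d` of a monomial ideal. -/
def numMinGens (I : Ideal (ExtAlg K n)) (d : ℕ) : ℕ :=
  {σ | σ ∈ minGens I ∧ σ.card = d}.ncard

end Ideals

/-- The first `p` sets in colexicographic order among the `d`-subsets of `{1, …, m}` (all of them
if there are fewer than `p`). For sets of equal size, `σ` precedes `τ` in colexicographic order iff
`e_σ` is larger than `e_τ` in the reverse lexicographic order, so these are the index sets of the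
`p` revlex-largest monomials of degree `d` in `K⟨e₁, …, e_m⟩`. -/
def colexSegment (m d p : ℕ) : Finset (Finset (Fin m)) :=
  {σ ∈ Finset.powersetCard d Finset.univ |
    Finset.card {τ ∈ Finset.powersetCard d (Finset.univ : Finset (Fin m)) |
      toColex τ < toColex σ} < p}

/-- For a monomial ideal `I` of `K⟨e₁, …, eₙ⟩` generated in degree `d`, the colexsegment ideal
associated to `I`, formed in `K⟨e₁, …, e_m⟩`: it is generated by the `p` revlex-largest monomials of
degree `d`, where `p` is the number of minimal generators of `I`. It is meaningful as soon as
`K⟨e₁, …, e_m⟩` has at least `p` monomials of degree `d`. -/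
def colexsegmentIdeal {K : Type u} [Field K] {n : ℕ} (I : Ideal (ExtAlg K n)) (d m : ℕ) :
    Ideal (ExtAlg K m) :=
  Ideal.span (mono K '' (colexSegment m d (numMinGens I d) : Set (Finset (Fin m))))

section Tor

variable (K : Type u) [Field K] (n : ℕ)

/-- The relations `a m = ε(a) m` for `a ∈ E`, `m ∈ M`, where `ε : E → K` is the augmentation
`eᵢ ↦ 0`. -/
def augRel (M : ModuleCat.{u} (ExtAlg K n)) : Submodule K M :=
  Submodule.span K {x | ∃ (a : ExtAlg K n) (m : M),
    x = a • m - (ExteriorAlgebra.algebraMapInv (R := K) (M := Fin n → K) a) • m}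

variable {K n} in
theorem augRel_le_comap {M N : ModuleCat.{u} (ExtAlg K n)} (f : M ⟶ N) :
    augRel K n M ≤ (augRel K n N).comap (f.hom.restrictScalars K) := by
  refine Submodule.span_le.2 ?_
  rintro x ⟨a, m, rfl⟩
  refine Submodule.subset_span ⟨a, f.hom m, ?_⟩
  rw [map_sub, LinearMap.map_smul (f.hom.restrictScalars K), LinearMap.restrictScalars_apply,
    LinearMap.restrictScalars_apply, f.hom.map_smul]

/-- The functor `K ⊗_E −` from `E`-modules to `K`-vector spaces, where `E` acts on `K` through the
augmentation `ε : E → K`: it sends `M` to the quotient of `M = K ⊗_K M` by the relations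
`a m = ε(a) m`. -/
def tensorK : ModuleCat.{u} (ExtAlg K n) ⥤ ModuleCat.{u} K where
  obj M := ModuleCat.of K (M ⧸ augRel K n M)
  map f := ModuleCat.ofHom
    ((augRel K n _).mapQ (augRel K n _) (f.hom.restrictScalars K) (augRel_le_comap f))
  map_id M := by
    ext x
    rfl
  map_comp f g := by
    ext x
    rfl

instance : (tensorK K n).Additive where
  map_add {M N f g} := by
    refine ModuleCat.hom_ext (Submodule.linearMap_qext _ (LinearMap.ext fun x => ?_))
    exact congrArg (Submodule.mkQ (augRel K n N)) (LinearMap.add_apply f.hom g.hom x)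

/-- `Tor_i^E(M, K)` as a `K`-vector space: the `i`-th left derived functor of `K ⊗_E −`. -/
def torK (M : ModuleCat.{u} (ExtAlg K n)) (i : ℕ) : ModuleCat.{u} K :=
  ((tensorK K n).leftDerived i).obj M

variable {K n}

/-- The `i`-th total Betti number `β_i(I) = dim_K Tor_i^E(I, K)` of an ideal `I`. -/
def betti (I : Ideal (ExtAlg K n)) (i : ℕ) : ℕ :=
  Module.finrank K (torK K n (ModuleCat.of (ExtAlg K n) I) i)

end Tor

end

end ExteriorBetti

/-!
The theorem follows from a formula for the Betti numbers of a strongly stable ideal `I` generated in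
degree `d`: `β_i(I)` is the sum over the generators `e_σ` of the number of multisets of `i` indices
not exceeding `max σ` (`betti_eq_sum`). The colexsegment ideal `J` is again of this kind, and has as
many generators as `I`. For every `k`, an initial segment of the colexicographic order contains the
largest possible number of sets inside `{1, …, k}` among all families of `p` sets of size `d`
(`card_filter_top_le_colexSegment`), so the maxima of the generators of `J` are distributed lower
than those of `I`, and the two sums compare (`sum_le_sum_of_card_filter_le`).

The formula is proved by computing `Tor` with an explicit resolution. Let `D_i` have as basis the
multisets of `i` indices (the divided power monomials). The modules `E ⊗ D_i ⊗ I` with differential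
`∑ e_k ⊗ ∂_k ⊗ 1 ∓ ∑ 1 ⊗ ∂_k ⊗ e_k`, where `∂_k` removes the index `k` and the first `e_k`
multiplies on the right, form a free resolution of `I`. The first summand alone is the differential
of the Koszul complex of `E`, which is contractible onto `K`, and the second summand raises the
degree in `I`, so exactness follows by moving up the finitely many degrees of `I`
(`resD_exact_succ`, `resD_exact_zero`). After applying `K ⊗_E −` only the Cartan complex `D_i ⊗ I`
remains (`augCoeff_resD`).

In the Cartan complex, the pairs `(a, σ)` of a multiset `a` and an index set `σ` with `e_σ ∈ I` are
matched by moving the largest index `w` of `a` and `σ` between `a` and `σ`. The unmatched pairs are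
those with `w ∈ σ` and `e_{σ ∖ w} ∉ I`. The matching is a homotopy away from them
(`cartan_homotopy_succ`). For a strongly stable ideal, each unmatched `σ` is a generator
(`IsStableFamily.isCritical_iff`), hence no boundary has a coefficient there, and the unmatched
pairs index a basis of the homology.
-/

namespace ExteriorBetti

/-! ### Monomials as a basis of the exterior algebra -/

section Monomials

variable (K : Type u) [Field K] {n : ℕ}

/-- The monomials `e_σ`, as a `K`-basis of the exterior algebra. -/
noncomputable def monoBasis (n : ℕ) : Module.Basis (Finset (Fin n)) K (ExtAlg K n) :=
  (Pi.basisFun K (Fin n)).ExteriorAlgebra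

theorem monoBasis_apply (σ : Finset (Fin n)) : monoBasis K n σ = mono K σ := by
  rw [monoBasis, ExteriorAlgebra.basis_apply_ofCard _ rfl, mono]
  simp only [ExteriorAlgebra.ιMulti_family]
  congr 1
  ext i : 1
  simp only [Function.comp_apply, Pi.basisFun_apply]
  rfl

theorem mono_empty : mono K (∅ : Finset (Fin n)) = 1 := by
  simp only [mono, ExteriorAlgebra.ιMulti_apply]
  rfl

theorem mono_singleton (k : Fin n) : mono K {k} = gen K k := by
  simp only [mono, gen, ExteriorAlgebra.ιMulti_apply]
  have (i : Fin ({k} : Finset (Fin n)).card) : ({k} : Finset (Fin n)).orderEmbOfFin rfl i = k :=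
    Finset.mem_singleton.1 (Finset.orderEmbOfFin_mem _ rfl i)
  simp [this]

theorem gen_mul_gen_swap (k l : Fin n) :
    gen K k * gen K l = -(gen K l * gen K k) :=
  eq_neg_of_add_eq_zero_left (ExteriorAlgebra.ι_add_mul_swap _ _)

theorem gen_mul_gen_self (k : Fin n) : gen K k * gen K k = 0 :=
  ExteriorAlgebra.ι_sq_zero _

theorem mono_mul_mono_of_not_disjoint {σ τ : Finset (Fin n)} (h : ¬Disjoint σ τ) :
    mono K σ * mono K τ = 0 := by
  simp only [← monoBasis_apply]
  exact ExteriorAlgebra.basis_mul_of_not_disjoint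
    (Pi.basisFun K (Fin n)) (Set.powersetCard.ofCard (s := σ) rfl)
    (Set.powersetCard.ofCard (s := τ) rfl) h

theorem mono_mul_mono_of_disjoint {σ τ : Finset (Fin n)} (h : Disjoint σ τ) :
    ∃ c : K, c * c = 1 ∧ mono K σ * mono K τ = c • mono K (σ ∪ τ) := by
  have := ExteriorAlgebra.basis_mul_of_disjoint
    (Pi.basisFun K (Fin n)) (Set.powersetCard.ofCard (s := σ) rfl)
    (Set.powersetCard.ofCard (s := τ) rfl) h
  set c := Equiv.Perm.sign (Set.powersetCard.permOfDisjoint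
    (s := Set.powersetCard.ofCard (s := σ) rfl) (t := Set.powersetCard.ofCard (s := τ) rfl) h)
  refine ⟨((c : ℤ) : K), ?_, ?_⟩
  · rw [← Int.cast_mul, Int.units_coe_mul_self, Int.cast_one]
  · simp only [← monoBasis_apply]
    rw [Int.cast_smul_eq_zsmul]
    have e : ((Set.powersetCard.disjUnion (s := Set.powersetCard.ofCard (s := σ) rfl)
      (t := Set.powersetCard.ofCard (s := τ) rfl) h) : Finset (Fin n)) = σ ∪ τ := by
      ext x; simp [Set.powersetCard.disjUnion, Set.powersetCard.ofCard]
    rw [e] at this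
    exact this

/-- A system of signs for exterior multiplication on the exterior algebra of `K ^ n`: `s k τ` is
the coefficient with which multiplication by `e_k` takes `e_{τ ∖ k}` to `e_τ`; its value for
`k ∉ τ` plays no role. The swap law says that multiplications by different variables anticommute. -/
structure IsSignSystem {K : Type u} [Field K] {n : ℕ} (s : Fin n → Finset (Fin n) → K) : Prop where
  mul_self : ∀ k τ, s k τ * s k τ = 1
  swap : ∀ k l τ, k ∈ τ → l ∈ τ → k ≠ l →
    s k τ * s l (τ.erase k) = -(s l τ * s k (τ.erase l))

/-- Any family of anticommuting endomorphisms that adds one index to a monomial, up to sign,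
arises from a system of signs. It is applied to left and to right multiplication by the `e_k`. -/
theorem exists_isSignSystem (g : Fin n → Module.End K (ExtAlg K n))
    (hmem : ∀ k (σ : Finset (Fin n)), k ∈ σ → g k (mono K σ) = 0)
    (hnot : ∀ k (σ : Finset (Fin n)), k ∉ σ →
      ∃ c : K, c * c = 1 ∧ g k (mono K σ) = c • mono K (insert k σ))
    (hswap : ∀ k l x, g k (g l x) = -(g l (g k x))) :
    ∃ s : Fin n → Finset (Fin n) → K, IsSignSystem s ∧
      (∀ k τ, k ∈ τ → g k (mono K (τ.erase k)) = s k τ • mono K τ) ∧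
      ∀ k x τ, (monoBasis K n).repr (g k x) τ =
        if k ∈ τ then s k τ * (monoBasis K n).repr x (τ.erase k) else 0 := by
  have key : ∀ k (τ : Finset (Fin n)), ∃ c : K, c * c = 1 ∧
      (k ∈ τ → g k (mono K (τ.erase k)) = c • mono K τ) := by
    intro k τ
    by_cases hk : k ∈ τ
    · obtain ⟨c, hc, h⟩ := hnot k (τ.erase k) (Finset.notMem_erase k τ)
      rw [Finset.insert_erase hk] at h
      exact ⟨c, hc, fun _ => h⟩
    · exact ⟨1, one_mul 1, fun h => absurd h hk⟩
  choose s hs1 hs2 using key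
  have hne : ∀ τ : Finset (Fin n), mono K τ ≠ 0 := fun τ => by
    rw [← monoBasis_apply]; exact (monoBasis K n).ne_zero τ
  refine ⟨s, ⟨hs1, ?_⟩, hs2, ?_⟩
  · intro k l τ hk hl hkl
    have h1 : g k (g l (mono K ((τ.erase k).erase l))) =
        (s l (τ.erase k) * s k τ) • mono K τ := by
      rw [hs2 l (τ.erase k) (Finset.mem_erase.2 ⟨hkl.symm, hl⟩), map_smul, hs2 k τ hk, smul_smul]
    have h2 : g l (g k (mono K ((τ.erase l).erase k))) =
        (s k (τ.erase l) * s l τ) • mono K τ := by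
      rw [hs2 k (τ.erase l) (Finset.mem_erase.2 ⟨hkl, hk⟩), map_smul, hs2 l τ hl, smul_smul]
    rw [hswap, Finset.erase_right_comm, h2, ← neg_smul] at h1
    have := smul_left_injective K (hne τ) h1
    linear_combination -this
  · intro k x τ
    induction (monoBasis K n).mem_span x using Submodule.span_induction with
    | zero => simp
    | add x y _ _ hx hy =>
      rw [map_add, map_add, Finsupp.add_apply, hx, hy]; split_ifs <;> simp [mul_add]
    | smul c x _ hx =>
      rw [map_smul, map_smul, Finsupp.smul_apply, hx]; split_ifs <;> simp [mul_left_comm]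
    | mem x hx =>
      obtain ⟨σ, rfl⟩ := hx
      rw [monoBasis_apply]
      by_cases hσ : k ∈ σ
      · rw [hmem k σ hσ, ← monoBasis_apply, Module.Basis.repr_self]
        have : σ ≠ τ.erase k := by rintro rfl; simp at hσ
        simp [this]
      · have h := hs2 k (insert k σ) (Finset.mem_insert_self k σ)
        rw [Finset.erase_insert hσ] at h
        rw [h, map_smul, ← monoBasis_apply, ← monoBasis_apply, Module.Basis.repr_self,
          Module.Basis.repr_self, Finsupp.smul_apply, Finsupp.single_apply, Finsupp.single_apply]
        by_cases hτ : insert k σ = τ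
        · subst hτ
          simp [Finset.erase_insert hσ]
        · rw [if_neg hτ, smul_zero]
          split_ifs with h1 h2
          · subst h2; exact absurd (Finset.insert_erase h1) hτ
          · simp
          · rfl

theorem gen_mul_mono_of_mem {k : Fin n} {σ : Finset (Fin n)} (h : k ∈ σ) :
    gen K k * mono K σ = 0 := by
  rw [← mono_singleton]
  exact mono_mul_mono_of_not_disjoint K (by simpa using h)

theorem gen_mul_mono_of_notMem {k : Fin n} {σ : Finset (Fin n)} (h : k ∉ σ) :
    ∃ c : K, c * c = 1 ∧ gen K k * mono K σ = c • mono K (insert k σ) := by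
  rw [← mono_singleton, Finset.insert_eq]
  exact mono_mul_mono_of_disjoint K (by simpa using h)

theorem exists_isSignSystem_left : ∃ s : Fin n → Finset (Fin n) → K, IsSignSystem s ∧
    (∀ k τ, k ∈ τ → gen K k * mono K (τ.erase k) = s k τ • mono K τ) ∧
    ∀ k x τ, (monoBasis K n).repr (gen K k * x) τ =
      if k ∈ τ then s k τ * (monoBasis K n).repr x (τ.erase k) else 0 :=
  exists_isSignSystem K (fun k => LinearMap.mulLeft K (gen K k))
    (fun _ _ h => gen_mul_mono_of_mem K h) (fun _ _ h => gen_mul_mono_of_notMem K h)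
    fun k l x => by
      simp only [LinearMap.mulLeft_apply]
      rw [← mul_assoc, gen_mul_gen_swap, neg_mul, mul_assoc]

theorem exists_isSignSystem_right : ∃ s : Fin n → Finset (Fin n) → K, IsSignSystem s ∧
    ∀ k x τ, (monoBasis K n).repr (x * gen K k) τ =
      if k ∈ τ then s k τ * (monoBasis K n).repr x (τ.erase k) else 0 := by
  obtain ⟨s, h1, -, h2⟩ := exists_isSignSystem K (fun k : Fin n => LinearMap.mulRight K (gen K k))
    (fun k σ h => by
      rw [LinearMap.mulRight_apply, ← mono_singleton]
      exact mono_mul_mono_of_not_disjoint K (by simpa using h))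
    (fun k σ h => by
      rw [LinearMap.mulRight_apply, ← mono_singleton, Finset.insert_eq, Finset.union_comm]
      exact mono_mul_mono_of_disjoint K (by simpa using h))
    fun k l x => by
      simp only [LinearMap.mulRight_apply]
      rw [mul_assoc, gen_mul_gen_swap, mul_neg, mul_assoc]
  exact ⟨s, h1, h2⟩

end Monomials

/-! ### The Cartan complex of a family of index sets -/

section Cartan

open scoped Classical in
/-- The Cartan differential. For a family `U` of index sets, the elements of homological degree `i`
are the functions `z : Sym (Fin n) i → U → N`; such a `z` stands for the sum of the
`z(a, σ) e_σ x^(a)`, where `x^(a)` is the divided power monomial with exponent the multiset `a`.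
The differential lowers `x^(a)` by one variable `x_k` and multiplies `e_σ` by `e_k`, and drops the
terms that leave `U`. -/
noncomputable def cartan {K : Type u} [Field K] {n : ℕ} (s : Fin n → Finset (Fin n) → K)
    (U : Set (Finset (Fin n))) (R : Type*) [Ring R] {N : Type*} [AddCommGroup N] [Module K N]
    [Module R N] [SMulCommClass R K N] (i : ℕ) :
    (Sym (Fin n) (i + 1) → U → N) →ₗ[R] (Sym (Fin n) i → U → N) where
  toFun z b τ := ∑ k ∈ τ.1,
    if h : τ.1.erase k ∈ U then s k τ • z (k ::ₛ b) ⟨τ.1.erase k, h⟩ else 0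
  map_add' x y := by
    ext b τ
    simp only [Pi.add_apply, ← Finset.sum_add_distrib]
    refine Finset.sum_congr rfl fun k _ => ?_
    split_ifs <;> simp
  map_smul' r x := by
    ext b τ
    simp only [Pi.smul_apply, RingHom.id_apply, Finset.smul_sum]
    refine Finset.sum_congr rfl fun k _ => ?_
    split_ifs
    · exact (smul_comm r _ _).symm
    · simp

variable {K : Type u} [Field K] {n : ℕ} {s : Fin n → Finset (Fin n) → K}
  {U : Set (Finset (Fin n))}

open scoped Classical in
theorem cartan_apply {R : Type*} [Ring R] {N : Type*} [AddCommGroup N] [Module K N]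
    [Module R N] [SMulCommClass R K N] (i : ℕ) (z : Sym (Fin n) (i + 1) → U → N)
    (b : Sym (Fin n) i) (τ : U) :
    cartan s U R i z b τ = ∑ k ∈ τ.1,
      if h : τ.1.erase k ∈ U then s k τ • z (k ::ₛ b) ⟨τ.1.erase k, h⟩ else 0 := rfl

theorem insert_mem_of_isUpperSet (hU : IsUpperSet U) (w : Fin n) (τ : U) : insert w τ.1 ∈ U :=
  hU (Finset.subset_insert w τ.1) τ.2

open scoped Classical in
/-- The homotopy on the Cartan complex: if the largest index `w` of `(b, τ)` does not belong to
`τ`, it is moved from the multiset `b` to the set `τ`. In the sum below at most one term, that of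
the largest index, is nonzero. -/
noncomputable def homotopy (s : Fin n → Finset (Fin n) → K) (hU : IsUpperSet U) (i : ℕ) :
    (Sym (Fin n) i → U → K) →ₗ[K] (Sym (Fin n) (i + 1) → U → K) where
  toFun z b τ := ∑ w,
    if h : w ∈ b ∧ w ∉ τ.1 ∧ (∀ x ∈ b, x ≤ w) ∧ ∀ x ∈ τ.1, x ≤ w then
      s w (insert w τ) * z (b.erase w h.1) ⟨insert w τ, insert_mem_of_isUpperSet hU w τ⟩
    else 0
  map_add' x y := by
    ext b τ
    simp only [Pi.add_apply, ← Finset.sum_add_distrib]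
    refine Finset.sum_congr rfl fun k _ => ?_
    split_ifs <;> simp [mul_add]
  map_smul' r x := by
    ext b τ
    simp only [Pi.smul_apply, RingHom.id_apply, Finset.smul_sum]
    refine Finset.sum_congr rfl fun k _ => ?_
    split_ifs <;> simp [mul_left_comm]

open scoped Classical in
theorem homotopy_apply (hU : IsUpperSet U) (i : ℕ) (z : Sym (Fin n) i → U → K)
    (b : Sym (Fin n) (i + 1)) (τ : U) :
    homotopy s hU i z b τ = ∑ w,
      if h : w ∈ b ∧ w ∉ τ.1 ∧ (∀ x ∈ b, x ≤ w) ∧ ∀ x ∈ τ.1, x ≤ w then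
        s w (insert w τ) * z (b.erase w h.1) ⟨insert w τ, insert_mem_of_isUpperSet hU w τ⟩
      else 0 := rfl

theorem homotopy_cons (hU : IsUpperSet U) {i : ℕ} (z : Sym (Fin n) i → U → K)
    {w : Fin n} {a : Sym (Fin n) i} {τ : U} (hw : w ∉ τ.1) (ha : ∀ x ∈ a, x ≤ w)
    (hτ : ∀ x ∈ τ.1, x ≤ w) :
    homotopy s hU i z (w ::ₛ a) τ =
      s w (insert w τ) * z a ⟨insert w τ, insert_mem_of_isUpperSet hU w τ⟩ := by
  have hb : ∀ x ∈ w ::ₛ a, x ≤ w := by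
    intro x hx
    rcases Sym.mem_cons.1 hx with rfl | hx
    · exact le_rfl
    · exact ha x hx
  refine (Finset.sum_eq_single w (fun v _ hv => ?_)
    fun h => absurd (Finset.mem_univ w) h).trans ?_
  · rw [dif_neg]
    rintro ⟨h1, -, h3, -⟩
    exact hv (le_antisymm (hb v h1) (h3 w (Sym.mem_cons_self w a)))
  · rw [dif_pos ⟨Sym.mem_cons_self w a, hw, hb, hτ⟩, Sym.erase_cons_head]

theorem homotopy_eq_zero (hU : IsUpperSet U) {i : ℕ} (z : Sym (Fin n) i → U → K)
    {w : Fin n} {b : Sym (Fin n) (i + 1)} {τ : U} (hw : w ∈ τ.1) (hb : ∀ x ∈ b, x ≤ w) :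
    homotopy s hU i z b τ = 0 := by
  rw [homotopy_apply]
  refine Finset.sum_eq_zero fun v _ => ?_
  rw [dif_neg]
  rintro ⟨h1, h2, -, h4⟩
  exact h2 (le_antisymm (hb v h1) (h4 w hw) ▸ hw)

/-- The pairs `(a, σ)` that the homotopy leaves unmatched: those whose largest index belongs to `σ`
and cannot be removed from `σ` within `U`, and the pair of empty sets. -/
def IsCritical (U : Set (Finset (Fin n))) {i : ℕ} (a : Sym (Fin n) i) (σ : Finset (Fin n)) : Prop :=
  (∃ w ∈ σ, (∀ x ∈ a, x ≤ w) ∧ (∀ x ∈ σ, x ≤ w) ∧ σ.erase w ∉ U) ∨ i = 0 ∧ σ = ∅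

theorem cartan_homotopy_of_mem (hs : IsSignSystem s) (hU : IsUpperSet U) {i : ℕ}
    (z : Sym (Fin n) i → U → K) (hz : ∀ a (σ : U), IsCritical U a σ.1 → z a σ = 0)
    {w : Fin n} {b : Sym (Fin n) i} {τ : U} (hw : w ∈ τ.1) (hb : ∀ x ∈ b, x ≤ w)
    (hτ : ∀ x ∈ τ.1, x ≤ w) :
    cartan s U K i (homotopy s hU i z) b τ = z b τ := by
  rw [cartan_apply, Finset.sum_eq_single_of_mem w hw]
  · split_ifs with h
    · rw [homotopy_cons hU z (by simp) hb fun x hx => hτ x (Finset.mem_of_mem_erase hx)]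
      simp only [Finset.insert_erase hw, smul_eq_mul]
      rw [← mul_assoc, hs.mul_self, one_mul]
    · exact (hz b τ (Or.inl ⟨w, hw, hb, hτ, h⟩)).symm
  · intro k hk hkw
    split_ifs with h
    · rw [homotopy_eq_zero hU z (w := w) (by simp [hw, hkw.symm]), smul_zero]
      intro x hx
      rcases Sym.mem_cons.1 hx with rfl | hx
      · exact hτ _ hk
      · exact hb x hx
    · rfl

theorem cartan_homotopy_zero (hs : IsSignSystem s) (hU : IsUpperSet U)
    (z : Sym (Fin n) 0 → U → K) (hz : ∀ a (σ : U), IsCritical U a σ.1 → z a σ = 0) :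
    cartan s U K 0 (homotopy s hU 0 z) = z := by
  ext b τ
  have hb : ∀ x, x ∉ b := fun x hx => by
    rw [Sym.eq_nil_of_card_zero b] at hx
    exact Sym.notMem_nil x hx
  rcases τ.1.eq_empty_or_nonempty with h | h
  · rw [hz b τ (Or.inr ⟨rfl, h⟩), cartan_apply]
    exact Finset.sum_eq_zero fun k hk => by simp [h] at hk
  · exact cartan_homotopy_of_mem hs hU z hz (τ.1.max'_mem h) (fun x hx => absurd hx (hb x))
      fun x hx => τ.1.le_max' x hx

theorem cartan_homotopy_succ (hs : IsSignSystem s) (hU : IsUpperSet U) {i : ℕ}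
    (z : Sym (Fin n) (i + 1) → U → K) (hz : ∀ a (σ : U), IsCritical U a σ.1 → z a σ = 0) :
    cartan s U K (i + 1) (homotopy s hU (i + 1) z) + homotopy s hU i (cartan s U K i z) = z := by
  ext b τ
  simp only [Pi.add_apply]
  -- `w` is the largest index that occurs in `b` or in `τ`.
  obtain ⟨w, hw, hwb, hwτ⟩ : ∃ w, (w ∈ b ∨ w ∈ τ.1) ∧ (∀ x ∈ b, x ≤ w) ∧ ∀ x ∈ τ.1, x ≤ w := by
    obtain ⟨v, hv⟩ := b.exists_mem
    have hmem : ∀ x, x ∈ (b : Multiset (Fin n)).toFinset ∪ τ.1 ↔ x ∈ b ∨ x ∈ τ.1 := fun x => by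
      rw [Finset.mem_union, Multiset.mem_toFinset, Sym.mem_coe]
    have hne : ((b : Multiset (Fin n)).toFinset ∪ τ.1).Nonempty := ⟨v, (hmem v).2 (Or.inl hv)⟩
    exact ⟨_, (hmem _).1 (Finset.max'_mem _ hne),
      fun x hx => Finset.le_max' _ x ((hmem x).2 (Or.inl hx)),
      fun x hx => Finset.le_max' _ x ((hmem x).2 (Or.inr hx))⟩
  by_cases hwmem : w ∈ τ.1
  · rw [cartan_homotopy_of_mem hs hU z hz hwmem hwb hwτ, homotopy_eq_zero hU _ hwmem hwb, add_zero]
  obtain ⟨a, rfl⟩ := Sym.exists_cons_of_mem (hw.resolve_right hwmem)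
  have ha : ∀ x ∈ a, x ≤ w := fun x hx => hwb x (Sym.mem_cons_of_mem hx)
  rw [homotopy_cons hU _ hwmem ha hwτ, cartan_apply, cartan_apply]
  simp only
  rw [Finset.sum_insert hwmem, mul_add]
  have h0 : ∀ h : (insert w τ.1).erase w ∈ U,
      z (w ::ₛ a) ⟨(insert w τ.1).erase w, h⟩ = z (w ::ₛ a) τ := fun h =>
    congrArg (z (w ::ₛ a)) (Subtype.ext (Finset.erase_insert hwmem))
  rw [dif_pos (by rw [Finset.erase_insert hwmem]; exact τ.2), h0, smul_eq_mul, ← mul_assoc,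
    hs.mul_self, one_mul, add_left_comm, Finset.mul_sum, ← Finset.sum_add_distrib,
    Finset.sum_eq_zero, add_zero]
  intro k hk
  have hkw : k ≠ w := fun h => hwmem (h ▸ hk)
  have e : (insert w τ.1).erase k = insert w (τ.1.erase k) :=
    Finset.erase_insert_of_ne hkw.symm
  have hins : ∀ x ∈ insert w (τ.1.erase k), x ≤ w := by
    intro x hx
    rcases Finset.mem_insert.1 hx with rfl | hx
    · exact le_rfl
    · exact hwτ x (Finset.mem_of_mem_erase hx)
  have hka : ∀ x ∈ k ::ₛ a, x ≤ w := by
    intro x hx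
    rcases Sym.mem_cons.1 hx with rfl | hx
    · exact hwτ _ hk
    · exact ha x hx
  have h0' : ∀ h : (insert w τ.1).erase k ∈ U, z (k ::ₛ a) ⟨(insert w τ.1).erase k, h⟩ =
      z (k ::ₛ a) ⟨insert w (τ.1.erase k), e ▸ h⟩ := fun h =>
    congrArg (z (k ::ₛ a)) (Subtype.ext e)
  by_cases h1 : τ.1.erase k ∈ U
  · have h2 : (insert w τ.1).erase k ∈ U := e ▸ insert_mem_of_isUpperSet hU w ⟨_, h1⟩
    rw [dif_pos h1, dif_pos h2, h0', Sym.cons_swap,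
      homotopy_cons hU z (τ := ⟨_, h1⟩) (by simp [hwmem]) hka
        fun x hx => hwτ x (Finset.mem_of_mem_erase hx)]
    have := hs.swap w k (insert w τ.1) (by simp) (by simp [hk]) hkw.symm
    rw [e, Finset.erase_insert hwmem] at this
    have h3 := hs.mul_self w (insert w τ.1)
    have h4 := hs.mul_self w (insert w (τ.1.erase k))
    simp only [smul_eq_mul]
    generalize z (k ::ₛ a) ⟨insert w (τ.1.erase k), e ▸ h2⟩ = y at *
    linear_combination y * s w (insert w τ.1) * s w (insert w (τ.1.erase k)) * this -
      y * s k τ.1 * s w (insert w (τ.1.erase k)) * h3 -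
      y * s w (insert w τ.1) * s k (insert w τ.1) * h4
  · rw [dif_neg h1]
    split_ifs with h2
    · rw [h0', hz (k ::ₛ a) ⟨insert w (τ.1.erase k), e ▸ h2⟩ (Or.inl ⟨w, by simp, hka, hins, by
        rwa [Finset.erase_insert (by simp [hwmem])]⟩)]
      simp
    · simp

end Cartan

/-! ### The Koszul differential on the exterior algebra -/

section Koszul

variable (K : Type u) [Field K] {n : ℕ}

theorem sum_sum_eq_zero_of_swap {N ι : Type*} [AddCommGroup N] [Fintype ι] [DecidableEq ι]
    (f : ι → ι → N) (hself : ∀ k, f k k = 0) (hswap : ∀ k l, f k l = -f l k) :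
    ∑ k, ∑ l, f k l = 0 := by
  rw [← Finset.sum_product']
  refine Finset.sum_involution (fun p _ => (p.2, p.1)) (fun p _ => ?_) (fun p _ hp h => ?_)
    (fun _ _ => Finset.mem_univ _) (fun _ _ => rfl)
  · rw [hswap p.1 p.2, neg_add_cancel]
  · have : p.2 = p.1 := congrArg Prod.fst h
    exact hp (by rw [this, hself])

/-- The Koszul differential: it lowers `x^(a)` by one variable `x_k` and multiplies the
coefficients, which are elements of the exterior algebra, by `e_k` on the right. -/
noncomputable def koszul (n : ℕ) (V : Type*) (i : ℕ) :
    (Sym (Fin n) (i + 1) → V → ExtAlg K n) →ₗ[ExtAlg K n] (Sym (Fin n) i → V → ExtAlg K n) where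
  toFun z b τ := ∑ k, z (k ::ₛ b) τ * gen K k
  map_add' x y := by
    ext b τ
    simp only [Pi.add_apply, add_mul, Finset.sum_add_distrib]
  map_smul' r x := by
    ext b τ
    simp only [Pi.smul_apply, RingHom.id_apply, smul_eq_mul, mul_assoc, Finset.mul_sum]

variable {K} {V : Type*}

theorem koszul_apply (i : ℕ) (z : Sym (Fin n) (i + 1) → V → ExtAlg K n) (b : Sym (Fin n) i)
    (τ : V) : koszul K n V i z b τ = ∑ k, z (k ::ₛ b) τ * gen K k := rfl

theorem koszul_koszul (i : ℕ) (z : Sym (Fin n) (i + 2) → V → ExtAlg K n) :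
    koszul K n V i (koszul K n V (i + 1) z) = 0 := by
  ext b τ
  simp only [koszul_apply, Finset.sum_mul, mul_assoc, Pi.zero_apply]
  refine sum_sum_eq_zero_of_swap _ (fun k => ?_) fun k l => ?_
  · rw [gen_mul_gen_self, mul_zero]
  · rw [gen_mul_gen_swap, mul_neg, Sym.cons_swap]

theorem algebraMapInv_gen (k : Fin n) : ExteriorAlgebra.algebraMapInv (gen K k) = 0 := by
  simp [gen, ExteriorAlgebra.algebraMapInv]

theorem repr_empty_eq_algebraMapInv (x : ExtAlg K n) :
    (monoBasis K n).repr x ∅ = ExteriorAlgebra.algebraMapInv x := by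
  have : (Finsupp.lapply ∅ ∘ₗ (monoBasis K n).repr.toLinearMap) =
      (ExteriorAlgebra.algebraMapInv (R := K) (M := Fin n → K)).toLinearMap := by
    refine (monoBasis K n).ext fun σ => ?_
    rw [LinearMap.comp_apply, LinearEquiv.coe_coe, Module.Basis.repr_self, Finsupp.lapply_apply,
      monoBasis_apply, AlgHom.toLinearMap_apply]
    rcases σ.eq_empty_or_nonempty with rfl | ⟨k, hk⟩
    · rw [mono_empty, map_one, Finsupp.single_eq_same]
    · obtain ⟨s, hs, h, -⟩ := exists_isSignSystem_left K (n := n)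
      have h1 := congrArg (s k σ • ·) (h k σ hk)
      simp only [smul_smul, hs.mul_self, one_smul] at h1
      rw [← h1, map_smul, map_mul, algebraMapInv_gen, zero_mul, smul_zero,
        Finsupp.single_eq_of_ne (by rintro rfl; simp at hk)]
  exact LinearMap.congr_fun this x

/-- The Koszul complex of the exterior algebra is contractible onto `K`. The contraction acts on
each component `τ : V` separately. -/
theorem exists_koszul_homotopy (K : Type u) [Field K] (n : ℕ) (V : Type*) :
    ∃ H : ∀ i, (Sym (Fin n) i → V → ExtAlg K n) →ₗ[K] (Sym (Fin n) (i + 1) → V → ExtAlg K n),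
      (∀ i z, koszul K n V (i + 1) (H (i + 1) z) + H i (koszul K n V i z) = z) ∧
      (∀ z, (∀ a τ, ExteriorAlgebra.algebraMapInv (z a τ) = 0) → koszul K n V 0 (H 0 z) = z) ∧
      ∀ i z τ, (∀ a, z a τ = 0) → ∀ b, H i z b τ = 0 := by
  obtain ⟨s, hs, hrep⟩ := exists_isSignSystem_right K (n := n)
  let c : ExtAlg K n ≃ₗ[K] (↥(Set.univ : Set (Finset (Fin n))) → K) :=
    ((monoBasis K n).reindex (Equiv.Set.univ _).symm).equivFun
  have hc : ∀ x σ, c x σ = (monoBasis K n).repr x σ.1 := fun x σ => by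
    simp [c]
  let H : ∀ i, (Sym (Fin n) i → V → ExtAlg K n) →ₗ[K] (Sym (Fin n) (i + 1) → V → ExtAlg K n) :=
    fun i => LinearMap.pi fun b => LinearMap.pi fun τ => c.symm.toLinearMap ∘ₗ
      LinearMap.proj b ∘ₗ homotopy s isUpperSet_univ i ∘ₗ
      LinearMap.pi fun a => c.toLinearMap ∘ₗ LinearMap.proj τ ∘ₗ LinearMap.proj a
  have hH : ∀ i z b τ, c (H i z b τ) = homotopy s isUpperSet_univ i (fun a => c (z a τ)) b :=
    fun i z b τ => c.apply_symm_apply _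
  have hk : ∀ i (z : Sym (Fin n) (i + 1) → V → ExtAlg K n) b τ,
      c (koszul K n V i z b τ) = cartan s Set.univ K i (fun a => c (z a τ)) b := by
    intro i z b τ
    ext ρ
    rw [hc, koszul_apply, map_sum, Finsupp.finsetSum_apply, cartan_apply]
    simp only [hrep, Set.mem_univ, dite_true, hc, smul_eq_mul]
    rw [Finset.sum_ite_mem, Finset.univ_inter]
  refine ⟨H, fun i z => ?_, fun z hz => ?_, fun i z τ hz b => ?_⟩
  · ext b τ
    apply c.injective
    rw [Pi.add_apply, Pi.add_apply, map_add, hk, hH]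
    simp only [hH, hk]
    refine congrFun (cartan_homotopy_succ hs isUpperSet_univ (fun a => c (z a τ)) ?_) b
    rintro a σ (⟨w, -, -, -, h⟩ | ⟨h, -⟩)
    · exact absurd (Set.mem_univ _) h
    · omega
  · ext b τ
    apply c.injective
    rw [hk]
    simp only [hH]
    refine congrFun (cartan_homotopy_zero hs isUpperSet_univ (fun a => c (z a τ)) ?_) b
    rintro a σ (⟨w, -, -, -, h⟩ | ⟨-, h⟩)
    · exact absurd (Set.mem_univ _) h
    · rw [hc, h, repr_empty_eq_algebraMapInv, hz]
  · apply c.injective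
    rw [hH, map_zero]
    simp only [hz, map_zero]
    exact congrFun (map_zero (homotopy s isUpperSet_univ i)) b

end Koszul

/-! ### The free resolution of a monomial ideal -/

section Resolution

variable {K : Type u} [Field K] {n : ℕ} {s : Fin n → Finset (Fin n) → K}
  {U : Set (Finset (Fin n))}

theorem cartan_cartan (hs : IsSignSystem s) (hU : IsUpperSet U) {R : Type*} [Ring R] {N : Type*}
    [AddCommGroup N] [Module K N] [Module R N] [SMulCommClass R K N] (i : ℕ)
    (z : Sym (Fin n) (i + 2) → U → N) : cartan s U R i (cartan s U R (i + 1) z) = 0 := by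
  classical
  ext b τ
  let f : Fin n → Fin n → N := fun k l =>
    if h : k ∈ τ.1 ∧ l ∈ τ.1.erase k ∧ (τ.1.erase k).erase l ∈ U then
      (s k τ * s l (τ.1.erase k)) • z (l ::ₛ k ::ₛ b) ⟨(τ.1.erase k).erase l, h.2.2⟩ else 0
  have hf : ∀ k ∈ τ.1, (if h : τ.1.erase k ∈ U then
      s k τ • cartan s U R (i + 1) z (k ::ₛ b) ⟨τ.1.erase k, h⟩ else 0) = ∑ l, f k l := by
    intro k hk
    have h1 : ∀ l, f k l = if l ∈ τ.1.erase k then f k l else 0 := by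
      intro l
      split_ifs with hl
      · rfl
      · exact dif_neg fun h => hl h.2.1
    rw [Finset.sum_congr rfl fun l _ => h1 l, Finset.sum_ite_mem, Finset.univ_inter]
    split_ifs with h
    · rw [cartan_apply, Finset.smul_sum]
      refine Finset.sum_congr rfl fun l hl => ?_
      by_cases h2 : (τ.1.erase k).erase l ∈ U
      · simp only [f]
        rw [dif_pos h2, dif_pos ⟨hk, hl, h2⟩, smul_smul]
      · simp only [f]
        rw [dif_neg h2, dif_neg fun h => h2 h.2.2, smul_zero]
    · refine (Finset.sum_eq_zero fun l hl => dif_neg fun h3 => h ?_).symm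
      exact hU (Finset.erase_subset l _) h3.2.2
  rw [cartan_apply, Finset.sum_congr rfl hf, Pi.zero_apply, Pi.zero_apply]
  rw [Finset.sum_subset (Finset.subset_univ τ.1) fun k _ hk =>
    Finset.sum_eq_zero fun l _ => dif_neg fun h => hk h.1]
  refine sum_sum_eq_zero_of_swap f (fun k => dif_neg fun h => by simp at h) fun k l => ?_
  by_cases h : k ∈ τ.1 ∧ l ∈ τ.1.erase k ∧ (τ.1.erase k).erase l ∈ U
  · have hl := Finset.mem_erase.1 h.2.1
    have h' : l ∈ τ.1 ∧ k ∈ τ.1.erase l ∧ (τ.1.erase l).erase k ∈ U :=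
      ⟨hl.2, Finset.mem_erase.2 ⟨hl.1.symm, h.1⟩, Finset.erase_right_comm (s := τ.1) ▸ h.2.2⟩
    simp only [f]
    rw [dif_pos h, dif_pos h', hs.swap k l τ h.1 hl.2 hl.1.symm, neg_smul, Sym.cons_swap]
    congr 3
    exact Subtype.ext Finset.erase_right_comm
  · have h' : ¬(l ∈ τ.1 ∧ k ∈ τ.1.erase l ∧ (τ.1.erase l).erase k ∈ U) := by
      rintro ⟨h1, h2, h3⟩
      have hk := Finset.mem_erase.1 h2
      exact h ⟨hk.2, Finset.mem_erase.2 ⟨hk.1.symm, h1⟩,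
        Finset.erase_right_comm (s := τ.1) ▸ h3⟩
    simp only [f]
    rw [dif_neg h, dif_neg h', neg_zero]

theorem koszul_cartan_comm (i : ℕ) (z : Sym (Fin n) (i + 2) → U → ExtAlg K n) :
    koszul K n U i (cartan s U (ExtAlg K n) (i + 1) z) =
      cartan s U (ExtAlg K n) i (koszul K n U (i + 1) z) := by
  ext b τ
  simp only [koszul_apply, cartan_apply, Finset.sum_mul]
  rw [Finset.sum_comm]
  refine Finset.sum_congr rfl fun k _ => ?_
  split_ifs with h
  · rw [Finset.smul_sum]
    refine Finset.sum_congr rfl fun l _ => ?_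
    rw [smul_mul_assoc, Sym.cons_swap]
  · simp

/-- The differential of the free resolution of the monomial ideal with index sets `U`: the
difference, with alternating sign, of the Koszul differential on the coefficients and the Cartan
differential on the ideal. -/
noncomputable def resD (s : Fin n → Finset (Fin n) → K) (U : Set (Finset (Fin n))) (i : ℕ) :
    (Sym (Fin n) (i + 1) → U → ExtAlg K n) →ₗ[ExtAlg K n] (Sym (Fin n) i → U → ExtAlg K n) :=
  koszul K n U i - (-1 : ℤ) ^ i • cartan s U (ExtAlg K n) i

theorem resD_apply (i : ℕ) (z : Sym (Fin n) (i + 1) → U → ExtAlg K n) :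
    resD s U i z = koszul K n U i z - (-1 : ℤ) ^ i • cartan s U (ExtAlg K n) i z := rfl

theorem resD_resD (hs : IsSignSystem s) (hU : IsUpperSet U) (i : ℕ)
    (z : Sym (Fin n) (i + 2) → U → ExtAlg K n) : resD s U i (resD s U (i + 1) z) = 0 := by
  simp only [resD_apply, map_sub, map_zsmul, koszul_koszul, koszul_cartan_comm,
    cartan_cartan hs hU, pow_succ]
  simp

/-- The Cartan differential raises the number of indices in `σ`: if `z` vanishes up to some size of
`σ`, its image vanishes up to the next size. -/
theorem cartan_eq_zero_of_card {m i : ℕ} {z : Sym (Fin n) (i + 1) → U → ExtAlg K n}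
    (hz : ∀ a (τ : U), τ.1.card + (m + 1) ≤ n → z a τ = 0) (b : Sym (Fin n) i) (τ : U)
    (hτ : τ.1.card + m ≤ n) : cartan s U (ExtAlg K n) i z b τ = 0 := by
  rw [cartan_apply]
  refine Finset.sum_eq_zero fun k hk => ?_
  split_ifs
  · rw [hz, smul_zero]
    have := Finset.card_erase_add_one hk
    simp only
    omega
  · rfl

theorem resD_exact_succ {i : ℕ} (hs : IsSignSystem s) (hU : IsUpperSet U)
    (z : Sym (Fin n) (i + 1) → U → ExtAlg K n) (hz : resD s U i z = 0) :
    ∃ y, resD s U (i + 1) y = z := by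
  obtain ⟨H, H1, -, H3⟩ := exists_koszul_homotopy K n U
  -- Subtracting the boundary of `H z` pushes a cycle up by one level.
  suffices h : ∀ (m : ℕ) (z : Sym (Fin n) (i + 1) → U → ExtAlg K n),
      (∀ a (τ : U), τ.1.card + m ≤ n → z a τ = 0) → resD s U i z = 0 →
      ∃ y, resD s U (i + 1) y = z from
    h (n + 1) z (fun a τ h => by omega) hz
  intro m
  induction m with
  | zero =>
    intro z hz _
    refine ⟨0, ?_⟩
    rw [map_zero]
    ext a τ
    rw [hz a τ (by simpa using card_finset_fin_le τ.1)]
    rfl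
  | succ m ih =>
    intro z hz hz0
    have hc : koszul K n U i z = (-1 : ℤ) ^ i • cartan s U (ExtAlg K n) i z := by
      rwa [resD_apply, sub_eq_zero] at hz0
    have e : z - resD s U (i + 1) (H (i + 1) z) = H i (koszul K n U i z) +
        (-1 : ℤ) ^ (i + 1) • cartan s U (ExtAlg K n) (i + 1) (H (i + 1) z) := by
      nth_rw 1 [← H1 i z]
      rw [resD_apply]
      abel
    obtain ⟨y, hy⟩ := ih (z - resD s U (i + 1) (H (i + 1) z)) (by
      intro a τ hτ
      have h1 : H i (koszul K n U i z) a τ = 0 := H3 i _ τ (fun b => by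
        rw [hc, Pi.smul_apply, Pi.smul_apply, cartan_eq_zero_of_card hz b τ hτ, smul_zero]) a
      rw [e, Pi.add_apply, Pi.add_apply, h1, Pi.smul_apply, Pi.smul_apply,
        cartan_eq_zero_of_card (fun a τ h => H3 _ _ τ (fun b => hz b τ h) a) a τ hτ, smul_zero,
        add_zero]) (by rw [map_sub, hz0, resD_resD hs hU, sub_zero])
    exact ⟨y + H (i + 1) z, by rw [map_add, hy, sub_add_cancel]⟩

open scoped Classical in
/-- The augmentation of the free resolution, with values in the exterior algebra. -/
noncomputable def resAug (U : Set (Finset (Fin n))) :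
    (Sym (Fin n) 0 → U → ExtAlg K n) →ₗ[ExtAlg K n] ExtAlg K n where
  toFun z := ∑ σ : U, z Sym.nil σ * mono K σ.1
  map_add' x y := by
    simp only [Pi.add_apply, add_mul, Finset.sum_add_distrib]
  map_smul' r x := by
    simp only [Pi.smul_apply, RingHom.id_apply, smul_eq_mul, mul_assoc, Finset.mul_sum]

theorem resAug_apply [Fintype U] (z : Sym (Fin n) 0 → U → ExtAlg K n) :
    resAug U z = ∑ σ : U, z Sym.nil σ * mono K σ.1 := by
  simp only [resAug, LinearMap.coe_mk, AddHom.coe_mk]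
  congr!

theorem resAug_resD (hU : IsUpperSet U)
    (hs : ∀ k τ, k ∈ τ → gen K k * mono K (τ.erase k) = s k τ • mono K τ)
    (z : Sym (Fin n) 1 → U → ExtAlg K n) : resAug U (resD s U 0 z) = 0 := by
  classical
  rw [resD_apply, pow_zero, one_smul, map_sub, sub_eq_zero, resAug_apply, resAug_apply]
  -- `G k σ` is the common term of the two sums, extended by zero to all `σ`.
  let G : Fin n → Finset (Fin n) → ExtAlg K n := fun k σ =>
    if h : σ ∈ U then z (k ::ₛ Sym.nil) ⟨σ, h⟩ * (gen K k * mono K σ) else 0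
  have hsub : ∀ F : Finset (Fin n) → ExtAlg K n, (∀ σ, σ ∉ U → F σ = 0) →
      ∑ σ : U, F σ.1 = ∑ σ, F σ := by
    intro F hF
    rw [← Finset.sum_subtype (Finset.univ.filter (· ∈ U)) (by simp) F]
    exact Finset.sum_subset (Finset.subset_univ _) fun σ _ h => hF σ (by simpa using h)
  have h1 : ∑ σ : U, koszul K n U 0 z Sym.nil σ * mono K σ.1 = ∑ σ, ∑ k, G k σ := by
    rw [← hsub (fun σ => ∑ k, G k σ) fun σ h => Finset.sum_eq_zero fun k _ => dif_neg h]
    refine Finset.sum_congr rfl fun σ _ => ?_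
    rw [koszul_apply, Finset.sum_mul]
    refine Finset.sum_congr rfl fun k _ => ?_
    simp only [G]
    rw [dif_pos σ.2, mul_assoc]
  have h2 : ∑ τ : U, cartan s U (ExtAlg K n) 0 z Sym.nil τ * mono K τ.1 =
      ∑ τ, ∑ k ∈ τ, G k (τ.erase k) := by
    rw [← hsub (fun τ => ∑ k ∈ τ, G k (τ.erase k)) fun τ h => Finset.sum_eq_zero fun k _ =>
      dif_neg fun h' => h (hU (Finset.erase_subset k τ) h')]
    refine Finset.sum_congr rfl fun τ _ => ?_
    rw [cartan_apply, Finset.sum_mul]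
    refine Finset.sum_congr rfl fun k hk => ?_
    simp only [G]
    split_ifs with h
    · rw [hs k τ hk, smul_mul_assoc, mul_smul_comm]
    · rw [zero_mul]
  rw [h1, h2, Finset.sum_comm]
  have h3 : ∑ τ : Finset (Fin n), ∑ k ∈ τ, G k (τ.erase k) =
      ∑ k, ∑ τ : Finset (Fin n) with k ∈ τ, G k (τ.erase k) := by
    simp only [Finset.sum_filter]
    rw [Finset.sum_comm]
    exact Finset.sum_congr rfl fun τ _ => by rw [Finset.sum_ite_mem, Finset.univ_inter]
  rw [h3]
  refine Finset.sum_congr rfl fun k _ => ?_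
  rw [← Finset.sum_filter_add_sum_filter_not Finset.univ (k ∈ ·), Finset.sum_eq_zero, zero_add]
  · refine Finset.sum_nbij' (insert k) (Finset.erase · k) ?_ ?_ ?_ ?_ ?_
    · simp
    · simp
    · intro σ hσ
      exact Finset.erase_insert (by simpa using hσ)
    · intro σ hσ
      exact Finset.insert_erase (by simpa using hσ)
    · intro σ hσ
      rw [Finset.erase_insert (by simpa using hσ)]
  · intro σ hσ
    simp only [G]
    split_ifs
    · rw [gen_mul_mono_of_mem K (by simpa using hσ), mul_zero]
    · rfl

theorem resD_exact_zero (z : Sym (Fin n) 0 → U → ExtAlg K n)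
    (hs : ∀ z, resAug U (resD s U 0 z) = 0) (hz : resAug U z = 0) :
    ∃ y, resD s U 0 y = z := by
  classical
  obtain ⟨H, -, H2, H3⟩ := exists_koszul_homotopy K n U
  -- Up to boundaries, every element has constant coefficients.
  suffices h : ∀ (m : ℕ) (z : Sym (Fin n) 0 → U → ExtAlg K n),
      (∀ a (τ : U), τ.1.card + m ≤ n → z a τ = 0) →
      ∃ y, ∃ c : U → K, z - resD s U 0 y = fun _ τ => algebraMap K (ExtAlg K n) (c τ) by
    obtain ⟨y, c, hc⟩ := h (n + 1) z (fun a τ h => by omega)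
    have h0 : resAug U (z - resD s U 0 y) = 0 := by rw [map_sub, hz, hs, sub_zero]
    rw [hc, resAug_apply] at h0
    simp only [← Algebra.smul_def, ← monoBasis_apply] at h0
    have hli := ((monoBasis K n).linearIndependent.comp ((↑) : U → Finset (Fin n))
      Subtype.val_injective)
    have hc0 := Fintype.linearIndependent_iff.1 hli c h0
    refine ⟨y, ?_⟩
    rw [eq_comm, ← sub_eq_zero, hc]
    ext a τ
    rw [hc0, map_zero]
    rfl
  intro m
  induction m with
  | zero =>
    intro z hz
    refine ⟨0, 0, ?_⟩
    ext a τ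
    rw [map_zero, sub_zero, hz a τ (by simpa using card_finset_fin_le τ.1), Pi.zero_apply, map_zero]
  | succ m ih =>
    intro z hz
    let c : U → K := fun τ => ExteriorAlgebra.algebraMapInv (z Sym.nil τ)
    let z₀ : Sym (Fin n) 0 → U → ExtAlg K n := fun _ τ => algebraMap K (ExtAlg K n) (c τ)
    have hc : ∀ τ : U, τ.1.card + (m + 1) ≤ n → c τ = 0 := fun τ h => by
      simp only [c]
      rw [hz _ τ h, map_zero]
    have e := H2 (z - z₀) fun a τ => by
      rw [Sym.eq_nil_of_card_zero a]
      simp only [Pi.sub_apply, map_sub, z₀, c]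
      rw [ExteriorAlgebra.algebraMap_leftInverse, sub_self]
    have e2 : z - resD s U 0 (H 0 (z - z₀)) =
        z₀ + cartan s U (ExtAlg K n) 0 (H 0 (z - z₀)) := by
      rw [resD_apply, e, pow_zero, one_smul]
      abel
    obtain ⟨y, c', hy⟩ := ih (cartan s U (ExtAlg K n) 0 (H 0 (z - z₀))) fun a τ hτ =>
      cartan_eq_zero_of_card (fun a τ h => H3 _ _ τ (fun b => by
        simp only [Pi.sub_apply, z₀]
        rw [hz b τ h, hc τ h, map_zero, sub_zero]) a) a τ hτ
    refine ⟨H 0 (z - z₀) + y, c + c', ?_⟩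
    rw [map_add, ← sub_sub, e2, add_sub_assoc, hy]
    ext a τ
    simp [z₀]

end Resolution

/-! ### Homology of the Cartan complex -/

section CartanHomology

variable {K : Type u} [Field K] {n : ℕ} {s : Fin n → Finset (Fin n) → K}
  {U : Set (Finset (Fin n))}

theorem cartan_apply_of_isCritical
    (hmin : ∀ (i : ℕ) (a : Sym (Fin n) i), ∀ σ ∈ U, IsCritical U a σ → ∀ k ∈ σ, σ.erase k ∉ U)
    {i : ℕ} (z : Sym (Fin n) (i + 1) → U → K) {a : Sym (Fin n) i} {σ : U}
    (h : IsCritical U a σ.1) : cartan s U K i z a σ = 0 := by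
  rw [cartan_apply]
  exact Finset.sum_eq_zero fun k hk => dif_neg (hmin i a σ σ.2 h k hk)

theorem cartan_homotopy_of_cycle (hs : IsSignSystem s) (hU : IsUpperSet U) {i : ℕ}
    (z : Sym (Fin n) i → U → K) (hz : ∀ a (σ : U), IsCritical U a σ.1 → z a σ = 0)
    (hcyc : ∀ (j : ℕ) (e : i = j + 1), cartan s U K j (fun a => z (Sym.cast e.symm a)) = 0) :
    cartan s U K i (homotopy s hU i z) = z := by
  cases i with
  | zero => exact cartan_homotopy_zero hs hU z hz
  | succ i =>
    have h := cartan_homotopy_succ hs hU z hz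
    have h0 : cartan s U K i z = 0 := hcyc i rfl
    rwa [h0, map_zero, add_zero] at h

theorem exists_cycle_of_isCritical (hs : IsSignSystem s) (hU : IsUpperSet U)
    (hmin : ∀ (i : ℕ) (a : Sym (Fin n) i), ∀ σ ∈ U, IsCritical U a σ → ∀ k ∈ σ, σ.erase k ∉ U)
    {i : ℕ} (x : Sym (Fin n) (i + 1) → U → K) :
    ∃ z : Sym (Fin n) (i + 1) → U → K, cartan s U K i z = 0 ∧
      ∀ a (σ : U), IsCritical U a σ.1 → z a σ = x a σ := by
  refine ⟨x - homotopy s hU i (cartan s U K i x), ?_, fun a σ h => ?_⟩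
  · rw [map_sub, cartan_homotopy_of_cycle hs hU _
      fun a σ h => cartan_apply_of_isCritical hmin x h, sub_self]
    rintro j rfl
    exact cartan_cartan hs hU j x
  · rcases h with ⟨w, hw, ha, -, -⟩ | ⟨h, -⟩
    · rw [Pi.sub_apply, Pi.sub_apply, homotopy_eq_zero hU _ hw ha, sub_zero]
    · omega

end CartanHomology

/-! ### Computation of Tor -/

section TorComputation

variable {K : Type u} [Field K] {n : ℕ} {s : Fin n → Finset (Fin n) → K}
  {U : Set (Finset (Fin n))}

/-- The `i`-th module of the free resolution of the monomial ideal with index sets `U`. -/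
noncomputable def resObj (K : Type u) [Field K] {n : ℕ} (U : Set (Finset (Fin n))) (i : ℕ) :
    ModuleCat.{u} (ExtAlg K n) :=
  ModuleCat.of (ExtAlg K n) (Sym (Fin n) i → U → ExtAlg K n)

/-- The differential of the free resolution, as a morphism of modules. -/
noncomputable def resHom (s : Fin n → Finset (Fin n) → K) (U : Set (Finset (Fin n))) (i : ℕ) :
    resObj K U (i + 1) ⟶ resObj K U i :=
  ModuleCat.ofHom (resD s U i)

/-- The free resolution of a monomial ideal as a chain complex of modules. -/
noncomputable abbrev resComplex (hs : IsSignSystem s) (hU : IsUpperSet U) :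
    ChainComplex (ModuleCat.{u} (ExtAlg K n)) ℕ :=
  ChainComplex.of (resObj K U) (resHom s U)
    fun i => ModuleCat.hom_ext (LinearMap.ext fun z => resD_resD hs hU i z)

theorem resComplex_d (hs : IsSignSystem s) (hU : IsUpperSet U) (i : ℕ) :
    (resComplex hs hU).d (i + 1) i = resHom s U i := by
  simp

/-- The complex `resComplex` as a projective resolution of the ideal. -/
noncomputable def resProjective (hs : IsSignSystem s) (hU : IsUpperSet U)
    (hgen : ∀ k τ, k ∈ τ → gen K k * mono K (τ.erase k) = s k τ • mono K τ)
    (I : Ideal (ExtAlg K n)) (hI : LinearMap.range (resAug U) = I) :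
    ProjectiveResolution (ModuleCat.of (ExtAlg K n) I) where
  complex := resComplex hs hU
  projective i :=
    (IsProjective.iff_projective (Sym (Fin n) i → U → ExtAlg K n)).1 inferInstance
  π := (ChainComplex.toSingle₀Equiv _ _).symm
    ⟨ModuleCat.ofHom ((resAug U).codRestrict I fun z => hI ▸ LinearMap.mem_range_self _ z), by
      rw [resComplex_d]
      exact ModuleCat.hom_ext (LinearMap.ext fun z => Subtype.ext (resAug_resD hU hgen z))⟩
  quasiIso := ⟨fun i => by
    cases i
    · rw [ChainComplex.quasiIsoAt₀_iff, ShortComplex.quasiIso_iff_of_zeros']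
      · let S : ShortComplex (ModuleCat.{u} (ExtAlg K n)) := ShortComplex.mk
          (X₁ := resObj K U 1) (X₂ := resObj K U 0) (X₃ := ModuleCat.of _ I) (resHom s U 0)
          (ModuleCat.ofHom
            ((resAug U).codRestrict I fun z => hI ▸ LinearMap.mem_range_self _ z))
          (ModuleCat.hom_ext (LinearMap.ext fun z => Subtype.ext (resAug_resD hU hgen z)))
        have hS : S.Exact ∧ Epi S.g := by
          constructor
          · rw [ShortComplex.moduleCat_exact_iff]
            intro x hx
            exact resD_exact_zero x (resAug_resD hU hgen) (congrArg Subtype.val hx)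
          · rw [ModuleCat.epi_iff_surjective]
            rintro ⟨x, hx⟩
            obtain ⟨z, hz⟩ := hI ▸ hx
            exact ⟨z, Subtype.ext hz⟩
        refine (ShortComplex.exact_and_epi_g_iff_of_iso ?_).2 hS
        exact ShortComplex.isoMk (Iso.refl _) (Iso.refl _) (Iso.refl _)
          ((Category.id_comp _).trans ((resComplex_d hs hU 0).symm.trans (Category.comp_id _).symm))
          ((Category.id_comp _).trans (Eq.trans
            (ChainComplex.toSingle₀Equiv_symm_apply_f_zero (C := resComplex hs hU)
              (X := ModuleCat.of _ I) _ _).symm (Category.comp_id _).symm))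
      all_goals rfl
    · rw [quasiIsoAt_iff_exactAt' _ _ (ChainComplex.exactAt_succ_single_obj _ _),
        HomologicalComplex.exactAt_iff' _ _ _ _ (ChainComplex.prev _ _)
          (ChainComplex.next_nat_succ _), ShortComplex.moduleCat_exact_iff]
      intro x hx
      have hx' : (resComplex hs hU).d _ _ x = 0 := hx
      rw [resComplex_d] at hx'
      obtain ⟨y, hy⟩ := resD_exact_succ hs hU x hx'
      refine ⟨y, ?_⟩
      have : (resComplex hs hU).d _ _ y = x := by
        rw [resComplex_d]
        exact hy
      exact this⟩

theorem finrank_homology_eq (S : ShortComplex (ModuleCat.{u} K)) {W : Type*} [AddCommGroup W]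
    [Module K W] (c : S.X₂ →ₗ[K] W) (h1 : ∀ x, c (S.f x) = 0)
    (h2 : ∀ x, S.g x = 0 → c x = 0 → ∃ y, S.f y = x) (h3 : ∀ w, ∃ x, S.g x = 0 ∧ c x = w) :
    Module.finrank K S.homology = Module.finrank K W := by
  let c' : LinearMap.ker S.g.hom →ₗ[K] W := c ∘ₗ Submodule.subtype _
  have hc' : Function.Surjective c' := fun w => by
    obtain ⟨x, hx, hw⟩ := h3 w
    exact ⟨⟨x, hx⟩, hw⟩
  have hker : LinearMap.range S.moduleCatToCycles = LinearMap.ker c' := by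
    ext x
    constructor
    · rintro ⟨y, rfl⟩
      exact h1 y
    · intro hx
      obtain ⟨y, hy⟩ := h2 x.1 x.2 hx
      exact ⟨y, Subtype.ext hy⟩
  exact (S.moduleCatHomologyIso.toLinearEquiv.trans
    ((Submodule.quotEquivOfEq _ _ hker).trans (c'.quotKerEquivOfSurjective hc'))).finrank_eq

/-- Reduction of the coefficients along the augmentation `E → K`. -/
noncomputable def augCoeff (U : Set (Finset (Fin n))) (i : ℕ) :
    resObj K U i →ₗ[K] (Sym (Fin n) i → U → K) where
  toFun z a σ := ExteriorAlgebra.algebraMapInv (z a σ)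
  map_add' x y := by
    ext a σ
    exact map_add ExteriorAlgebra.algebraMapInv (x a σ) (y a σ)
  map_smul' r x := by
    ext a σ
    refine (map_mul ExteriorAlgebra.algebraMapInv (algebraMap K (ExtAlg K n) r) (x a σ)).trans ?_
    rw [ExteriorAlgebra.algebraMap_leftInverse]
    rfl

theorem augCoeff_apply (i : ℕ) (z : Sym (Fin n) i → U → ExtAlg K n) (a : Sym (Fin n) i) (σ : U) :
    augCoeff U i z a σ = ExteriorAlgebra.algebraMapInv (z a σ) := rfl

theorem augCoeff_surjective (i : ℕ) : Function.Surjective (augCoeff (K := K) U i) := fun x =>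
  ⟨fun a σ => algebraMap K _ (x a σ), by
    ext a σ
    exact ExteriorAlgebra.algebraMap_leftInverse _ _⟩

theorem smul_mem_augRel {M : ModuleCat.{u} (ExtAlg K n)} {a : ExtAlg K n}
    (ha : ExteriorAlgebra.algebraMapInv a = 0) (m : M) : a • m ∈ augRel K n M :=
  Submodule.subset_span ⟨a, m, by rw [ha, zero_smul, sub_zero]⟩

theorem augRel_eq_ker (i : ℕ) :
    augRel K n (resObj K U i) =
      LinearMap.ker (augCoeff U i) := by
  classical
  apply le_antisymm
  · refine Submodule.span_le.2 ?_
    rintro x ⟨a, m, rfl⟩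
    refine LinearMap.mem_ker.2 ((map_sub _ _ _).trans (sub_eq_zero.2 ?_))
    ext b σ
    exact (map_mul ExteriorAlgebra.algebraMapInv a (m b σ)).trans
      (congrFun (congrFun (map_smul (augCoeff U i) _ m) b) σ).symm
  · intro z hz
    -- `z` is the sum of the products of its coefficients with the standard basis vectors.
    let δ : Sym (Fin n) i → U → (Sym (Fin n) i → U → ExtAlg K n) := fun a σ =>
      Pi.single a (Pi.single σ 1)
    have hzsum : z = ∑ a, ∑ σ, z a σ • δ a σ := by
      funext b τ
      simp only [Finset.sum_apply, δ]
      rw [Finset.sum_eq_single b, Finset.sum_eq_single τ]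
      · simp
      · intro σ _ hσ
        simp [hσ.symm]
      · simp
      · intro a _ ha
        refine Finset.sum_eq_zero fun σ _ => ?_
        simp [ha.symm]
      · simp
    rw [hzsum]
    refine Submodule.sum_mem _ fun a _ => Submodule.sum_mem _ fun σ _ => ?_
    exact smul_mem_augRel (M := resObj K U i) (congrFun (congrFun hz a) σ) (δ a σ)

theorem augCoeff_resD (i : ℕ) (z : Sym (Fin n) (i + 1) → U → ExtAlg K n) :
    augCoeff U i (resD s U i z) = -((-1 : ℤ) ^ i • cartan s U K i (augCoeff U (i + 1) z)) := by
  ext a σ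
  have h1 : ExteriorAlgebra.algebraMapInv (koszul K n U i z a σ) = 0 := by
    rw [koszul_apply, map_sum]
    exact Finset.sum_eq_zero fun k _ => by rw [map_mul, algebraMapInv_gen, mul_zero]
  have h2 : ExteriorAlgebra.algebraMapInv (cartan s U (ExtAlg K n) i z a σ) =
      cartan s U K i (augCoeff U (i + 1) z) a σ := by
    rw [cartan_apply, cartan_apply, map_sum]
    refine Finset.sum_congr rfl fun k _ => ?_
    split_ifs
    · rw [map_smul]
      rfl
    · rw [map_zero]
  rw [augCoeff_apply, resD_apply, Pi.sub_apply, Pi.sub_apply, map_sub, h1, zero_sub,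
    Pi.smul_apply, Pi.smul_apply, map_zsmul, h2]
  rfl

end TorComputation

section TorDimension

variable {K : Type u} [Field K] {n : ℕ} {s : Fin n → Finset (Fin n) → K}
  {U : Set (Finset (Fin n))}

/-- The critical pairs of homological degree `i`. -/
abbrev CriticalPair (U : Set (Finset (Fin n))) (i : ℕ) : Type :=
  {p : Sym (Fin n) i × U // IsCritical U p.1 p.2.1}

/-- The coefficients at the critical pairs, as a linear map on `K ⊗_E P_i` for the free resolution
`P`. -/
noncomputable def criticalCoeff (K : Type u) [Field K] (U : Set (Finset (Fin n))) (i : ℕ) :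
    (tensorK K n).obj (resObj K U i) →ₗ[K] (CriticalPair U i → K) :=
  (augRel K n (resObj K U i)).liftQ
    ((LinearMap.pi fun p => LinearMap.proj p.1.2 ∘ₗ LinearMap.proj p.1.1) ∘ₗ augCoeff U i) (by
      rw [augRel_eq_ker]
      exact LinearMap.ker_le_ker_comp _ _)

theorem mkQ_eq_iff (i : ℕ) (x y : resObj K U i) :
    (augRel K n (resObj K U i)).mkQ x = (augRel K n (resObj K U i)).mkQ y ↔
      augCoeff U i x = augCoeff U i y := by
  rw [← sub_eq_zero, ← map_sub, Submodule.mkQ_apply, Submodule.Quotient.mk_eq_zero, augRel_eq_ker,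
    LinearMap.mem_ker, map_sub, sub_eq_zero]

theorem tensorK_map_resHom_eq_zero_iff (i : ℕ) (z : resObj K U (i + 1)) :
    (tensorK K n).map (resHom s U i) ((augRel K n (resObj K U (i + 1))).mkQ z) = 0 ↔
      cartan s U K i (augCoeff U (i + 1) z) = 0 := by
  refine (mkQ_eq_iff i (resD s U i z) 0).trans
    (Iff.trans (Eq.congr (augCoeff_resD i z) (map_zero _)) ?_)
  rw [neg_eq_zero]
  refine ⟨fun h => ?_, fun h => by rw [h, smul_zero]⟩
  have := congrArg ((-1 : ℤ) ^ i • ·) h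
  simpa [smul_smul, ← mul_pow] using this

/-- The homology of `K ⊗_E P` in degree `i` has the critical pairs as a basis. The
hypothesis `hg` describes the cycles, and makes everything a cycle if `i = 0`. -/
theorem finrank_homology_tensorK (hs : IsSignSystem s) (hU : IsUpperSet U)
    (hmin : ∀ (i : ℕ) (a : Sym (Fin n) i), ∀ σ ∈ U, IsCritical U a σ → ∀ k ∈ σ, σ.erase k ∉ U)
    (i : ℕ) {X : ModuleCat.{u} K} (g : (tensorK K n).obj (resObj K U i) ⟶ X)
    (zero : (tensorK K n).map (resHom s U i) ≫ g = 0)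
    (hg : ∀ z, g ((augRel K n (resObj K U i)).mkQ z) = 0 ↔ ∀ (j : ℕ) (e : i = j + 1),
      cartan s U K j (fun a => augCoeff U i z (Sym.cast e.symm a)) = 0) :
    Module.finrank K (ShortComplex.mk _ _ zero).homology = Nat.card (CriticalPair U i) := by
  classical
  rw [finrank_homology_eq _ (criticalCoeff K U i), Module.finrank_fintype_fun_eq_card,
    Nat.card_eq_fintype_card]
  · intro x
    obtain ⟨z, rfl⟩ := Submodule.mkQ_surjective _ x
    ext p
    refine (congrFun (congrFun (augCoeff_resD (s := s) i z) p.1.1) p.1.2).trans ?_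
    rw [Pi.neg_apply, Pi.neg_apply, Pi.smul_apply, Pi.smul_apply,
      cartan_apply_of_isCritical hmin _ p.2, smul_zero, neg_zero]
    rfl
  · intro x hx hc
    obtain ⟨z, rfl⟩ := Submodule.mkQ_surjective _ x
    have hcyc := (hg z).1 hx
    have h := cartan_homotopy_of_cycle hs hU (augCoeff U i z)
      (fun a σ h => congrFun hc ⟨(a, σ), h⟩) hcyc
    obtain ⟨y, hy⟩ := augCoeff_surjective (i + 1)
      (-((-1 : ℤ) ^ i • homotopy s hU i (augCoeff U i z)))
    refine ⟨(augRel K n (resObj K U (i + 1))).mkQ y, ?_⟩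
    refine (mkQ_eq_iff i _ _).2 ?_
    refine (augCoeff_resD i y).trans ?_
    rw [hy, map_neg, map_zsmul, smul_neg, neg_neg, smul_smul, ← mul_pow, h]
    simp
  · intro w
    -- Extend `w` by zero, and correct it to a cycle.
    let x : Sym (Fin n) i → U → K := fun a σ => if h : IsCritical U a σ.1 then w ⟨(a, σ), h⟩ else 0
    have hx : ∀ p : CriticalPair U i, x p.1.1 p.1.2 = w p := fun p => dif_pos p.2
    obtain ⟨z, hz, hzx⟩ : ∃ z : Sym (Fin n) i → U → K, (∀ (j : ℕ) (e : i = j + 1),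
        cartan s U K j (fun a => z (Sym.cast e.symm a)) = 0) ∧
        ∀ a (σ : U), IsCritical U a σ.1 → z a σ = x a σ := by
      cases i with
      | zero => exact ⟨x, fun j e => by omega, fun _ _ _ => rfl⟩
      | succ i =>
        obtain ⟨z, h1, h2⟩ := exists_cycle_of_isCritical hs hU hmin x
        refine ⟨z, fun j e => ?_, h2⟩
        obtain rfl : i = j := by omega
        exact h1
    obtain ⟨y, rfl⟩ := augCoeff_surjective i z
    refine ⟨(augRel K n (resObj K U i)).mkQ y, (hg y).2 hz, ?_⟩
    ext p
    rw [← hx]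
    exact hzx p.1.1 p.1.2 p.2

theorem isUpperSet_mono_mem (I : Ideal (ExtAlg K n)) : IsUpperSet {σ | mono K σ ∈ I} := by
  intro σ τ h hσ
  obtain ⟨c, hc, hmul⟩ := mono_mul_mono_of_disjoint K (σ := τ \ σ) (τ := σ) Finset.sdiff_disjoint
  rw [Finset.sdiff_union_of_subset h] at hmul
  have : mono K τ = (c • mono K (τ \ σ)) * mono K σ := by
    rw [smul_mul_assoc, hmul, smul_smul, hc, one_smul]
  rw [Set.mem_ofPred_eq, this]
  exact I.mul_mem_left _ hσ

theorem range_resAug {I : Ideal (ExtAlg K n)} (hI : IsMonomial I) :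
    LinearMap.range (resAug {σ | mono K σ ∈ I}) = I := by
  classical
  apply le_antisymm
  · rintro _ ⟨z, rfl⟩
    rw [resAug_apply]
    exact Submodule.sum_mem _ fun σ _ => I.mul_mem_left _ σ.2
  · obtain ⟨S, hS⟩ := hI
    conv_lhs => rw [hS]
    rw [Ideal.span, Submodule.span_le]
    rintro _ ⟨σ, hσ, rfl⟩
    have hσI : mono K σ ∈ I := by
      rw [hS]
      exact Ideal.subset_span ⟨σ, hσ, rfl⟩
    refine ⟨fun _ => Pi.single ⟨σ, hσI⟩ 1, ?_⟩
    rw [resAug_apply, Finset.sum_eq_single ⟨σ, hσI⟩]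
    · simp
    · intro τ _ hτ
      simp [hτ]
    · simp

/-- The Betti numbers of a monomial ideal count critical pairs, provided that no index at all can
be removed from the index set of a critical pair. -/
theorem betti_eq_card_criticalPair {I : Ideal (ExtAlg K n)} (hI : IsMonomial I)
    (hmin : ∀ (i : ℕ) (a : Sym (Fin n) i) (σ : Finset (Fin n)), mono K σ ∈ I →
      IsCritical {σ | mono K σ ∈ I} a σ → ∀ k ∈ σ, mono K (σ.erase k) ∉ I) (i : ℕ) :
    betti I i = Nat.card (CriticalPair {σ | mono K σ ∈ I} i) := by
  obtain ⟨s, hs, hgen, -⟩ := exists_isSignSystem_left K (n := n)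
  have hU := isUpperSet_mono_mem I
  set U : Set (Finset (Fin n)) := {σ | mono K σ ∈ I}
  let P := resProjective hs hU hgen I (range_resAug hI)
  let C := ((tensorK K n).mapHomologicalComplex (ComplexShape.down ℕ)).obj (resComplex hs hU)
  have e1 : betti I i = Module.finrank K (C.homology i) :=
    ((P.isoLeftDerivedObj (tensorK K n) i).toLinearEquiv).finrank_eq
  have hd : ∀ j, C.d (j + 1) j = (tensorK K n).map (resHom s U j) := fun j =>
    congrArg (tensorK K n).map (resComplex_d hs hU j)
  rw [e1]
  cases i with
  | zero =>
    rw [(C.homologyIsoSc' 1 0 0 (ChainComplex.prev _ _)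
      ChainComplex.next_nat_zero).toLinearEquiv.finrank_eq]
    have zero : (tensorK K n).map (resHom s U 0) ≫
      (0 : (tensorK K n).obj (resObj K U 0) ⟶ (tensorK K n).obj (resObj K U 0)) = 0 := by simp
    let e : C.sc' 1 0 0 ≅ ShortComplex.mk _ _ zero :=
      ShortComplex.isoMk (Iso.refl _) (Iso.refl _) (Iso.refl _)
        ((Category.id_comp _).trans ((hd 0).symm.trans (Category.comp_id _).symm))
        ((Category.id_comp _).trans (Eq.trans (C.shape 0 0 (by simp)).symm
          (Category.comp_id _).symm))
    rw [(ShortComplex.homologyMapIso e).toLinearEquiv.finrank_eq]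
    exact finrank_homology_tensorK hs hU hmin 0 _ zero fun z =>
      ⟨fun _ j e => by omega, fun _ => rfl⟩
  | succ i =>
    rw [(C.homologyIsoSc' (i + 2) (i + 1) i (ChainComplex.prev _ _)
      (ChainComplex.next_nat_succ _)).toLinearEquiv.finrank_eq]
    have zero : (tensorK K n).map (resHom s U (i + 1)) ≫ (tensorK K n).map (resHom s U i) = 0 := by
      exact (congrArg₂ (· ≫ ·) (hd (i + 1)) (hd i)).symm.trans (C.d_comp_d _ _ _)
    let e : C.sc' (i + 2) (i + 1) i ≅ ShortComplex.mk _ _ zero :=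
      ShortComplex.isoMk (Iso.refl _) (Iso.refl _) (Iso.refl _)
        ((Category.id_comp _).trans ((hd (i + 1)).symm.trans (Category.comp_id _).symm))
        ((Category.id_comp _).trans ((hd i).symm.trans (Category.comp_id _).symm))
    rw [(ShortComplex.homologyMapIso e).toLinearEquiv.finrank_eq]
    refine finrank_homology_tensorK hs hU hmin (i + 1) _ zero fun z => ?_
    refine (tensorK_map_resHom_eq_zero_iff i z).trans ⟨fun h j e => ?_, fun h => h i rfl⟩
    obtain rfl : i = j := by omega
    exact h

end TorDimension

/-! ### Stable families of index sets -/

section Stable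

variable {n : ℕ}

/-- The family of the index sets of the monomials in a proper strongly stable monomial ideal
generated in degree `d`. -/
structure IsStableFamily (U : Set (Finset (Fin n))) (d : ℕ) : Prop where
  isUpperSet : IsUpperSet U
  empty_notMem : ∅ ∉ U
  exists_subset : ∀ σ ∈ U, ∃ τ ⊆ σ, τ ∈ U ∧ τ.card = d
  exchange : ∀ σ ∈ U, ∀ j ∈ σ, ∀ i < j, i ∉ σ → insert i (σ.erase j) ∈ U

variable {U : Set (Finset (Fin n))} {d : ℕ}

theorem IsStableFamily.le_card (h : IsStableFamily U d) {σ : Finset (Fin n)} (hσ : σ ∈ U) :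
    d ≤ σ.card := by
  obtain ⟨τ, hτ, -, rfl⟩ := h.exists_subset σ hσ
  exact Finset.card_le_card hτ

/-- The position of the largest element of `σ`, counted from one; it is zero for `σ = ∅`. -/
def top (σ : Finset (Fin n)) : ℕ := σ.sup fun x => x.1 + 1

theorem top_le_iff {σ : Finset (Fin n)} {k : ℕ} : top σ ≤ k ↔ ∀ x ∈ σ, x.1 < k := by
  simp [top, Finset.sup_le_iff]

theorem exists_top {σ : Finset (Fin n)} (h : σ.Nonempty) :
    ∃ w ∈ σ, (∀ x ∈ σ, x ≤ w) ∧ top σ = w.1 + 1 := by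
  refine ⟨σ.max' h, σ.max'_mem h, σ.le_max', le_antisymm ?_ ?_⟩
  · exact top_le_iff.2 fun x hx => Nat.lt_succ_of_le (σ.le_max' x hx)
  · exact Finset.le_sup (f := fun x : Fin n => x.1 + 1) (σ.max'_mem h)

/-- The critical pairs of a stable family are the pairs of a generator `σ` and a multiset of
indices that do not exceed the largest element of `σ`. -/
theorem IsStableFamily.isCritical_iff (h : IsStableFamily U d) {i : ℕ} (a : Sym (Fin n) i)
    {σ : Finset (Fin n)} (hσ : σ ∈ U) :
    IsCritical U a σ ↔ σ.card = d ∧ ∀ x ∈ a, x.1 < top σ := by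
  have hne : σ.Nonempty := Finset.nonempty_iff_ne_empty.2 fun e => h.empty_notMem (e ▸ hσ)
  obtain ⟨v, hv, hmax, htop⟩ := exists_top hne
  constructor
  · rintro (⟨w, hw, ha, hwσ, hU⟩ | ⟨-, e⟩)
    · obtain rfl : w = v := le_antisymm (hmax w hw) (hwσ v hv)
      refine ⟨?_, fun x hx => by rw [htop]; exact Nat.lt_succ_of_le (ha x hx)⟩
      obtain ⟨τ, hτσ, hτ, hcard⟩ := h.exists_subset σ hσ
      by_contra hne'
      have hwτ : w ∈ τ := by
        by_contra hwτ
        exact hU (h.isUpperSet (fun x hx =>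
          Finset.mem_erase.2 ⟨fun e => hwτ (e ▸ hx), hτσ hx⟩) hτ)
      obtain ⟨j, hjσ, hjτ⟩ := Finset.exists_of_ssubset
        (hτσ.ssubset_of_ne fun e => hne' (e ▸ hcard))
      have hjw : j ≠ w := fun e => hjτ (e ▸ hwτ)
      -- Exchanging `w` for `j` in `τ` gives a member of `U` inside `σ ∖ {w}`.
      refine hU (h.isUpperSet ?_ (h.exchange τ hτ w hwτ j (lt_of_le_of_ne (hmax j hjσ) hjw) hjτ))
      intro x hx
      rcases Finset.mem_insert.1 hx with rfl | hx
      · exact Finset.mem_erase.2 ⟨hjw, hjσ⟩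
      · exact Finset.mem_erase.2 ⟨Finset.ne_of_mem_erase hx, hτσ (Finset.mem_of_mem_erase hx)⟩
    · exact absurd e hne.ne_empty
  · rintro ⟨hcard, ha⟩
    refine Or.inl ⟨v, hv, fun x hx => ?_, hmax, fun hU => ?_⟩
    · have := ha x hx
      rw [htop] at this
      exact Nat.le_of_lt_succ this
    · have h1 := h.le_card hU
      have h2 := Finset.card_erase_lt_of_mem hv
      omega

open scoped Classical in
/-- The generators of degree `d`. -/
noncomputable def gens (U : Set (Finset (Fin n))) (d : ℕ) : Finset (Finset (Fin n)) :=
  {σ | σ ∈ U ∧ σ.card = d}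

theorem mem_gens {σ : Finset (Fin n)} : σ ∈ gens U d ↔ σ ∈ U ∧ σ.card = d := by
  simp [gens]

theorem card_sym_lt (i : ℕ) {t : ℕ} (ht : t ≤ n) :
    Nat.card {a : Sym (Fin n) i // ∀ x ∈ a, x.1 < t} = Nat.multichoose t i := by
  let f : Sym (Fin t) i → {a : Sym (Fin n) i // ∀ x ∈ a, x.1 < t} := fun a =>
    ⟨a.map (Fin.castLE ht), fun x hx => by
      obtain ⟨y, -, rfl⟩ := Sym.mem_map.1 hx
      exact y.2⟩
  have hf : Function.Bijective f := by
    constructor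
    · intro a b hab
      exact Sym.map_injective (Fin.castLE_injective ht) i (congrArg Subtype.val hab)
    · rintro ⟨a, ha⟩
      refine ⟨a.attach.map fun x => ⟨x.1.1, ha x.1 x.2⟩, Subtype.ext ?_⟩
      simp only [f]
      rw [Sym.map_map]
      exact a.attach_map_coe
  rw [← Nat.card_congr (Equiv.ofBijective f hf), Nat.card_eq_fintype_card,
    Sym.card_sym_eq_multichoose, Fintype.card_fin]

theorem IsStableFamily.card_criticalPair (h : IsStableFamily U d) (i : ℕ) :
    Nat.card (CriticalPair U i) = ∑ σ ∈ gens U d, Nat.multichoose (top σ) i := by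
  classical
  let e : CriticalPair U i ≃ Σ σ : gens U d, {a : Sym (Fin n) i // ∀ x ∈ a, x.1 < top σ.1} :=
    { toFun := fun p => ⟨⟨p.1.2.1, mem_gens.2 ⟨p.1.2.2,
          ((h.isCritical_iff p.1.1 p.1.2.2).1 p.2).1⟩⟩,
        ⟨p.1.1, ((h.isCritical_iff p.1.1 p.1.2.2).1 p.2).2⟩⟩
      invFun := fun q => ⟨(q.2.1, ⟨q.1.1, (mem_gens.1 q.1.2).1⟩),
        (h.isCritical_iff q.2.1 (mem_gens.1 q.1.2).1).2 ⟨(mem_gens.1 q.1.2).2, q.2.2⟩⟩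
      left_inv := fun p => rfl
      right_inv := fun q => rfl }
  rw [Nat.card_congr e, Nat.card_sigma,
    ← Finset.sum_coe_sort (gens U d) fun σ => Nat.multichoose (top σ) i]
  exact Finset.sum_congr rfl fun σ _ => card_sym_lt i (top_le_iff.2 fun x _ => x.2)

end Stable

section StableIdeal

variable {K : Type u} [Field K] {n d : ℕ}

/-- The Betti numbers of a strongly stable ideal generated in degree `d`. -/
theorem betti_eq_sum {I : Ideal (ExtAlg K n)} (hI : IsMonomial I)
    (h : IsStableFamily {σ | mono K σ ∈ I} d) (i : ℕ) :
    betti I i = ∑ σ ∈ gens {σ | mono K σ ∈ I} d, Nat.multichoose (top σ) i := by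
  rw [betti_eq_card_criticalPair hI, h.card_criticalPair]
  intro i a σ hσ hcrit k hk hmem
  have h1 := ((h.isCritical_iff a hσ).1 hcrit).1
  have h2 := h.le_card (σ := σ.erase k) hmem
  have h3 := Finset.card_erase_lt_of_mem hk
  omega

theorem mono_mem_span_iff (S : Set (Finset (Fin n))) (σ : Finset (Fin n)) :
    mono K σ ∈ Ideal.span (mono K '' S) ↔ ∃ u ∈ S, u ⊆ σ := by
  constructor
  · intro hσ
    obtain ⟨s, -, -, hs⟩ := exists_isSignSystem_left K (n := n)
    -- The coefficients of an element of the ideal vanish at the sets that contain no `u ∈ S`.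
    let C : ExtAlg K n → Prop := fun x => ∀ τ, (∀ u ∈ S, ¬u ⊆ τ) → (monoBasis K n).repr x τ = 0
    have hadd : ∀ x y, C x → C y → C (x + y) := fun x y hx hy τ hτ => by
      rw [map_add, Finsupp.add_apply, hx τ hτ, hy τ hτ, add_zero]
    have hsmul : ∀ (c : K) x, C x → C (c • x) := fun c x hx τ hτ => by
      rw [map_smul, Finsupp.smul_apply, hx τ hτ, smul_zero]
    have hgen : ∀ k x, C x → C (gen K k * x) := fun k x hx τ hτ => by
      rw [hs]
      split_ifs
      · rw [hx _ fun u hu h => hτ u hu (h.trans (Finset.erase_subset k τ)), mul_zero]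
      · rfl
    have hmul : ∀ a x, C x → C (a * x) := by
      intro a
      induction a using ExteriorAlgebra.induction with
      | algebraMap r =>
        intro x hx
        rw [← Algebra.smul_def]
        exact hsmul r x hx
      | ι v =>
        intro x hx
        have hv : ExteriorAlgebra.ι K v = ∑ k, v k • gen K k := by
          conv_lhs => rw [pi_eq_sum_univ' v, map_sum]
          simp only [map_smul]
          rfl
        rw [hv, Finset.sum_mul]
        refine Finset.sum_induction _ C hadd (fun τ _ => by simp) fun k _ => ?_
        rw [smul_mul_assoc]
        exact hsmul _ _ (hgen k x hx)
      | mul a b ha hb =>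
        intro x hx
        rw [mul_assoc]
        exact ha _ (hb _ hx)
      | add a b ha hb =>
        intro x hx
        rw [add_mul]
        exact hadd _ _ (ha _ hx) (hb _ hx)
    have hC : ∀ x ∈ Ideal.span (mono K '' S), C x := by
      intro x hx
      refine Submodule.span_induction (p := fun x _ => C x) ?_ (fun τ _ => by simp)
        (fun x y _ _ => hadd x y) (fun a x _ => hmul a x) hx
      rintro _ ⟨u, hu, rfl⟩ τ hτ
      rw [← monoBasis_apply, Module.Basis.repr_self, Finsupp.single_eq_of_ne]
      rintro rfl
      exact hτ _ hu subset_rfl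
    by_contra! hcon
    have := hC _ hσ σ hcon
    rw [← monoBasis_apply, Module.Basis.repr_self, Finsupp.single_eq_same] at this
    exact one_ne_zero this
  · rintro ⟨u, hu, huσ⟩
    have hmem : mono K u ∈ Ideal.span (mono K '' S) := Ideal.subset_span ⟨u, hu, rfl⟩
    exact isUpperSet_mono_mem (Ideal.span (mono K '' S)) huσ hmem

theorem isStableFamily_of_isStronglyStable {I : Ideal (ExtAlg K n)} (hI : I ≠ ⊤)
    (hst : IsStronglyStable I) (hdeg : IsGeneratedInDegree I d) :
    IsStableFamily {σ | mono K σ ∈ I} d where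
  isUpperSet := isUpperSet_mono_mem I
  empty_notMem h := hI ((Ideal.eq_top_iff_one I).2 (by
    rw [← mono_empty K (n := n)]
    exact h))
  exists_subset σ hσ := by
    obtain ⟨τ, hτσ, hτ⟩ := (Set.toFinite {σ | mono K σ ∈ I}).isPWO.exists_le_minimal hσ
    exact ⟨τ, hτσ, hτ.prop, hdeg τ hτ⟩
  exchange σ hσ j hj i hij hi := by
    have hmem := hst.2 σ hσ j hj i hij
    obtain ⟨c, hc, h⟩ := gen_mul_mono_of_notMem K (k := i) (σ := σ.erase j)
      fun h => hi (Finset.mem_of_mem_erase h)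
    have : mono K (insert i (σ.erase j)) = algebraMap K (ExtAlg K n) c *
        (gen K i * mono K (σ.erase j)) := by
      rw [← Algebra.smul_def, h, smul_smul, hc, one_smul]
    rw [Set.mem_ofPred_eq, this]
    exact I.mul_mem_left _ hmem

theorem card_gens_eq_numMinGens {I : Ideal (ExtAlg K n)}
    (h : IsStableFamily {σ | mono K σ ∈ I} d) :
    (gens {σ | mono K σ ∈ I} d).card = numMinGens I d := by
  rw [numMinGens, ← Set.ncard_coe_finset]
  congr 1
  ext σ
  rw [Finset.mem_coe, mem_gens]
  refine ⟨fun hσ => ⟨⟨hσ.1, fun τ hτ hle => ?_⟩, hσ.2⟩,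
    fun hσ => ⟨Minimal.prop (P := fun τ => mono K τ ∈ I) hσ.1, hσ.2⟩⟩
  have h1 : d ≤ τ.card := h.le_card hτ
  exact (Finset.eq_of_subset_of_card_le hle (hσ.2.le.trans h1)).ge

end StableIdeal

/-! ### Colexsegments -/

section Colex

theorem card_filter_rank_lt {α : Type*} [LinearOrder α] (s : Finset α) {p : ℕ} (hp : p ≤ s.card) :
    {x ∈ s | {y ∈ s | y < x}.card < p}.card = p := by
  let r : α → ℕ := fun x => {y ∈ s | y < x}.card
  have hr : ∀ x ∈ s, ∀ y ∈ s, x < y → r x < r y := fun x hx y _ hxy =>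
    Finset.card_lt_card ⟨fun z hz => by
      simp only [Finset.mem_filter] at hz ⊢
      exact ⟨hz.1, hz.2.trans hxy⟩, fun h => by
      have := h (Finset.mem_filter.2 ⟨hx, hxy⟩)
      simp at this⟩
  have hinj : Set.InjOn r s := by
    intro x hx y hy hxy
    rcases lt_trichotomy x y with h | h | h
    · exact absurd hxy (hr x hx y hy h).ne
    · exact h
    · exact absurd hxy (hr y hy x hx h).ne'
  have himg : s.image r = Finset.range s.card := by
    refine Finset.eq_of_subset_of_card_le (fun k hk => ?_) ?_
    · obtain ⟨x, hx, rfl⟩ := Finset.mem_image.1 hk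
      exact Finset.mem_range.2 (Finset.card_lt_card (Finset.filter_ssubset.2 ⟨x, hx, lt_irrefl x⟩))
    · rw [Finset.card_image_of_injOn hinj, Finset.card_range]
  have h2 : {x ∈ s | r x < p}.image r = Finset.range p := by
    ext k
    constructor
    · intro hk
      obtain ⟨x, hx, rfl⟩ := Finset.mem_image.1 hk
      exact Finset.mem_range.2 (Finset.mem_filter.1 hx).2
    · intro hk
      have hk' := Finset.mem_range.1 hk
      have : k ∈ s.image r := himg ▸ Finset.mem_range.2 (hk'.trans_le hp)
      obtain ⟨x, hx, rfl⟩ := Finset.mem_image.1 this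
      exact Finset.mem_image.2 ⟨x, Finset.mem_filter.2 ⟨hx, hk'⟩, rfl⟩
  have h3 := Finset.card_image_of_injOn (s := {x ∈ s | r x < p})
    (hinj.mono (Finset.coe_subset.2 (Finset.filter_subset _ _)))
  rw [h2, Finset.card_range] at h3
  exact h3.symm

variable {m d p : ℕ}

theorem mem_colexSegment {σ : Finset (Fin m)} :
    σ ∈ colexSegment m d p ↔ σ.card = d ∧
      Finset.card {τ ∈ Finset.powersetCard d (Finset.univ : Finset (Fin m)) |
        toColex τ < toColex σ} < p := by
  simp [colexSegment, Finset.mem_powersetCard]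

theorem card_colexSegment (hp : p ≤ m.choose d) : (colexSegment m d p).card = p := by
  have h := card_filter_rank_lt
    ((Finset.powersetCard d (Finset.univ : Finset (Fin m))).map toColex.toEmbedding) (p := p)
    (by simpa using hp)
  rw [Finset.filter_map, Finset.card_map] at h
  simpa [colexSegment, Finset.filter_map, Function.comp_def] using h

theorem mem_colexSegment_of_lt {σ τ : Finset (Fin m)} (hσ : σ ∈ colexSegment m d p)
    (hτ : τ.card = d) (h : toColex τ < toColex σ) : τ ∈ colexSegment m d p := by
  rw [mem_colexSegment] at hσ ⊢
  refine ⟨hτ, lt_of_le_of_lt (Finset.card_le_card fun υ hυ => ?_) hσ.2⟩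
  rw [Finset.mem_filter] at hυ ⊢
  exact ⟨hυ.1, hυ.2.trans h⟩

theorem isStableFamily_colexsegment {K : Type u} [Field K] (h0 : p ≠ 0 → d ≠ 0) :
    IsStableFamily {σ | mono K σ ∈
      Ideal.span (mono K '' (colexSegment m d p : Set (Finset (Fin m))))} d where
  isUpperSet := isUpperSet_mono_mem _
  empty_notMem h := by
    obtain ⟨u, hu, hsub⟩ := (mono_mem_span_iff _ _).1 h
    rw [Finset.mem_coe, mem_colexSegment, Finset.subset_empty.1 hsub, Finset.card_empty] at hu
    exact h0 (by omega) hu.1.symm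
  exists_subset σ hσ := by
    obtain ⟨u, hu, hsub⟩ := (mono_mem_span_iff _ _).1 hσ
    exact ⟨u, hsub, Ideal.subset_span ⟨u, hu, rfl⟩, (mem_colexSegment.1 hu).1⟩
  exchange σ hσ j hj i hij hi := by
    obtain ⟨u, hu, hsub⟩ := (mono_mem_span_iff _ _).1 hσ
    refine (mono_mem_span_iff _ _).2 ?_
    by_cases hju : j ∈ u
    · have hiu : i ∉ u.erase j := fun h => hi (hsub (Finset.mem_of_mem_erase h))
      refine ⟨insert i (u.erase j), mem_colexSegment_of_lt hu ?_ ?_,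
        Finset.insert_subset_insert i (Finset.erase_subset_erase j hsub)⟩
      · rw [Finset.card_insert_of_notMem hiu, Finset.card_erase_add_one hju]
        exact (mem_colexSegment.1 hu).1
      · conv_rhs => rw [← Finset.insert_erase hju]
        exact (Finset.Colex.insert_lt_insert hiu (Finset.notMem_erase j u)).2 hij
    · exact ⟨u, hu, fun x hx => Finset.mem_insert_of_mem
        (Finset.mem_erase.2 ⟨fun e => hju (e ▸ hx), hsub hx⟩)⟩

theorem gens_colexsegment {K : Type u} [Field K] :
    gens {σ | mono K σ ∈ Ideal.span (mono K '' (colexSegment m d p : Set (Finset (Fin m))))} d =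
      colexSegment m d p := by
  ext σ
  rw [mem_gens]
  constructor
  · rintro ⟨h, hcard⟩
    obtain ⟨u, hu, hsub⟩ := (mono_mem_span_iff _ _).1 h
    rwa [← Finset.eq_of_subset_of_card_le hsub (hcard.trans (mem_colexSegment.1 hu).1.symm).le]
  · exact fun h => ⟨Ideal.subset_span ⟨σ, h, rfl⟩, (mem_colexSegment.1 h).1⟩

/-- Among the families of `p` sets of size `d`, the colexsegment has the largest number of members
contained in each initial interval. -/
theorem card_filter_top_le_colexSegment {n : ℕ} (A : Finset (Finset (Fin n)))
    (hA : ∀ σ ∈ A, σ.card = d) (hp : A.card ≤ m.choose d) (k : ℕ) :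
    {σ ∈ A | top σ ≤ k}.card ≤ {σ ∈ colexSegment m d A.card | top σ ≤ k}.card := by
  by_cases hall : ∀ σ ∈ colexSegment m d A.card, top σ ≤ k
  · rw [Finset.filter_true_of_mem hall, card_colexSegment hp]
    exact Finset.card_filter_le _ _
  · push Not at hall
    obtain ⟨σ, hσ, hk⟩ := hall
    have : ¬∀ x ∈ σ, x.1 < k := fun h => absurd (top_le_iff.2 h) hk.not_ge
    push Not at this
    obtain ⟨x, hx, hkx⟩ := this
    have hkm : k ≤ m := hkx.trans x.2.le
    calc {σ ∈ A | top σ ≤ k}.card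
        ≤ (Finset.powersetCard d {x : Fin n | x.1 < k}).card := by
          refine Finset.card_le_card fun τ hτ => ?_
          rw [Finset.mem_filter] at hτ
          refine Finset.mem_powersetCard.2 ⟨fun y hy => ?_, hA τ hτ.1⟩
          simpa using top_le_iff.1 hτ.2 y hy
      _ ≤ k.choose d := by
          rw [Finset.card_powersetCard, Fin.card_filter_val_lt]
          exact Nat.choose_le_choose d (min_le_right n k)
      _ = (Finset.powersetCard d {x : Fin m | x.1 < k}).card := by
          rw [Finset.card_powersetCard, Fin.card_filter_val_lt, min_eq_right hkm]
      _ ≤ {σ ∈ colexSegment m d A.card | top σ ≤ k}.card := by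
          refine Finset.card_le_card fun τ hτ => ?_
          rw [Finset.mem_powersetCard] at hτ
          have hτk : ∀ y ∈ τ, y.1 < k := fun y hy => by simpa using hτ.1 hy
          refine Finset.mem_filter.2 ⟨mem_colexSegment_of_lt hσ hτ.2 ?_, top_le_iff.2 hτk⟩
          by_contra hle
          exact lt_irrefl x (Finset.Colex.forall_lt_mono (not_lt.1 hle)
            (fun y hy => (hτk y hy).trans_le hkx) x hx)

/-- A sum of values of a monotone function `F`, computed by counting how often each increment of
`F` occurs. -/
theorem sum_eq_sum_increments {α : Type*} {F : ℕ → ℕ} (hF : Monotone F) (A : Finset α) (f : α → ℕ)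
    {N : ℕ} (hN : ∀ a ∈ A, f a ≤ N) :
    ∑ a ∈ A, F (f a) = A.card * F 0 +
      ∑ k ∈ Finset.range N, (A.card - {a ∈ A | f a ≤ k}.card) * (F (k + 1) - F k) := by
  have hsum : ∀ x ≤ N, F x = F 0 + ∑ k ∈ Finset.range N, if k < x then F (k + 1) - F k else 0 := by
    intro x hx
    have h1 : Finset.filter (· < x) (Finset.range N) = Finset.range x := by
      ext k
      simp only [Finset.mem_filter, Finset.mem_range]
      omega
    rw [← Finset.sum_filter, h1, Finset.sum_range_tsub hF, Nat.add_sub_cancel' (hF (Nat.zero_le x))]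
  rw [Finset.sum_congr rfl fun a ha => hsum (f a) (hN a ha), Finset.sum_add_distrib,
    Finset.sum_const, smul_eq_mul, Finset.sum_comm]
  congr 1
  refine Finset.sum_congr rfl fun k _ => ?_
  rw [← Finset.sum_filter, Finset.sum_const, smul_eq_mul]
  congr 1
  have := Finset.card_filter_add_card_filter_not (s := A) (fun a => f a ≤ k)
  simp only [not_le] at this
  omega

theorem sum_le_sum_of_card_filter_le {α β : Type*} (A : Finset α) (B : Finset β) (f : α → ℕ)
    (g : β → ℕ) (hcard : A.card = B.card)
    (h : ∀ k, {b ∈ B | g b ≤ k}.card ≤ {a ∈ A | f a ≤ k}.card) {F : ℕ → ℕ} (hF : Monotone F) :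
    ∑ a ∈ A, F (f a) ≤ ∑ b ∈ B, F (g b) := by
  rw [sum_eq_sum_increments hF A f (N := max (A.sup f) (B.sup g))
      fun a ha => (Finset.le_sup ha).trans (le_max_left _ _),
    sum_eq_sum_increments hF B g (N := max (A.sup f) (B.sup g))
      fun b hb => (Finset.le_sup hb).trans (le_max_right _ _), hcard]
  gcongr with k _
  exact h k

end Colex

theorem multichoose_monotone (i : ℕ) : Monotone fun t => Nat.multichoose t i := by
  intro s t hst
  simp only
  rcases s.eq_zero_or_pos with rfl | hs
  · cases i with
    | zero => simp
    | succ i => simp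
  · rw [Nat.multichoose_eq, Nat.multichoose_eq]
    exact Nat.choose_le_choose i (by omega)

theorem betti_colexsegmentIdeal_le {K : Type u} [Field K] {n d : ℕ} {I : Ideal (ExtAlg K n)}
    (hI : I ≠ ⊤) (hstable : IsStronglyStable I) (hdeg : IsGeneratedInDegree I d) {m : ℕ}
    (hm : numMinGens I d ≤ m.choose d) (i : ℕ) :
    betti (colexsegmentIdeal I d m) i ≤ betti I i := by
  have hS := isStableFamily_of_isStronglyStable hI hstable hdeg
  have hp := card_gens_eq_numMinGens hS
  have h0 : numMinGens I d ≠ 0 → d ≠ 0 := by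
    rintro h rfl
    rw [← hp, Finset.card_ne_zero] at h
    obtain ⟨σ, hσ⟩ := h
    rw [mem_gens, Finset.card_eq_zero] at hσ
    exact hS.empty_notMem (hσ.2 ▸ hσ.1)
  rw [betti_eq_sum hstable.1 hS, colexsegmentIdeal,
    betti_eq_sum ⟨_, rfl⟩ (isStableFamily_colexsegment h0), gens_colexsegment, ← hp]
  rw [← hp] at hm
  exact sum_le_sum_of_card_filter_le _ _ top top (card_colexSegment hm)
    (card_filter_top_le_colexSegment _ (fun σ hσ => (mem_gens.1 hσ).2) hm) (multichoose_monotone i)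

end ExteriorBetti

theorem theorem5p2 {K : Type u} [Field K] (n d : ℕ)
    (I : Ideal (ExteriorBetti.ExtAlg K n)) (hI : I ≠ ⊤)
    (hstable : ExteriorBetti.IsStronglyStable I)
    (hdeg : ExteriorBetti.IsGeneratedInDegree I d)
    (m : ℕ) (hm : ExteriorBetti.numMinGens I d ≤ m.choose d) (i : ℕ) :
    ExteriorBetti.betti (ExteriorBetti.colexsegmentIdeal I d m) i ≤ ExteriorBetti.betti I i := by
  exact ExteriorBetti.betti_colexsegmentIdeal_le hI hstable hdeg hm i
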